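/- Let $(\mathcal C,\otimes,I)$ be a closed braided monoidal category with braiding $\Phi$, with equalizers and coequalizers; $[X,-]$ denotes the right adjoint of $X\otimes-$. An object $X$ is *flat* if $X\otimes -$ preserves equalizers, and *faithfully flat* if $X\otimes -$ preserves and reflects equalizers. Let $H$ be a flat Hopf algebra in $\mathcal C$ with multiplication $\nabla_H$, unit $\eta_H$, comultiplication $\Delta_H$ and counit $\varepsilon_H$, and suppose that the braiding is $H$-linear, i.e. for all left $H$-modules $M,N$ in $\mathcal C$ the morphism $\Phi_{M,N}:M\otimes N\to N\otimes M$ is $H$-linear for the diagonal actions of $H$. Then the category ${}_H\mathcal C$ of left $H$-modules is a closed braided monoidal category with the braiding $\Phi$. An object $P$ of a closed braided monoidal category is *faithfully projective* if, with $P^*=[P,I]$, the canonical morphism $P^*\otimes P\to[P,P]$ is an isomorphism and evaluation induces an isomorphism $P\otimes_{[P,P]}P^*\cong I$. An algebra $A$ there, with opposite algebra $\overline A$ (multiplication $\nabla_A\Phi_{A,A}$), is *Azumaya* if it is faithfully projective and the canonical morphisms $A\otimes\overline A\to[A,A]$ and $\overline A\otimes A\to[A,A]$, induced by the left action $\nabla_A(A\otimes\nabla_A\Phi_{A,A}):A\otimes\overline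 A\otimes A\to A$ and by the right action $\nabla_A(\nabla_A\Phi_{A,A}\otimes A):A\otimes\overline A\otimes A\to A$, are isomorphisms. An *$H$-Azumaya algebra* is an Azumaya algebra in ${}_H\mathcal C$. Let $A$ be an $H$-Azumaya algebra with $H$-action $\nu:H\otimes A\to A$. The smash product $A\# H$ is the object $A\otimes H$ with unit $\eta_A\otimes\eta_H$ and multiplication $$(\nabla_A\otimes\nabla_H)(A\otimes\nu\otimes H\otimes H)(A\otimes H\otimes\Phi_{H,A}\otimes H)(A\otimes\Delta_H\otimes A\otimes H),$$ with the right $H$-coaction $A\otimes\Delta_H$. It is an $A$-bimodule by left and right multiplication along $A\otimes\eta_H:A\to A\# H$; write $l:A\otimes (A\# H)\to A\# H$ and $r:(A\# H)\otimes A\to A\# H$ for the two actions. Let $j:(A\# H)^A\to A\# H$ be the equalizer of the two morphisms $A\# H\to[A,A\# H]$ that correspond to $l$ and to $r\circ\Phi_{A,A\# H}$. Then $T=(A\# H)^A$ carries an algebra structure and a right $H$-comodule structure $\rho:T\to T\otimes H$ for which $j$ is a morphism of algebras and of right $H$-comodules, and with these structures $T$ is an $H$-Galois object: $T$ is a right $H$-comodule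 algebra (that is, $\rho$ is moreover an algebra morphism to the braided tensor product algebra $T\otimes H$), $T$ is faithfully flat, and the canonical morphism $\mathrm{can}_T=(\nabla_T\otimes H)(T\otimes\rho):T\otimes T\to T\otimes H$ is an isomorphism. -/

import Mathlib

open CategoryTheory MonoidalCategory Limits
open scoped MonObj ComonObj

universe v u

noncomputable section

namespace BraidedHopf

variable {C : Type u} [Category.{v} C] [MonoidalCategory.{v} C]

/-- The structure morphism `H ⊗ M ⟶ M` of a left `H`-module `M`. -/
def act (H : C) [MonObj H] (M : C) [ModObj H M] : H ⊗ M ⟶ M := γ[H, M]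

section Act

variable (H : C) [MonObj H]

lemma one_act (M : C) [ModObj H M] : η[H] ▷ M ≫ act H M = (λ_ M).hom :=
  ModObj.one_smul_self H M

lemma mul_act (M : C) [ModObj H M] :
    μ[H] ▷ M ≫ act H M = (α_ H H M).hom ≫ H ◁ act H M ≫ act H M :=
  ModObj.mul_smul_self H M

variable {H} in
lemma act_hom {M N : Mod C H} (f : M ⟶ N) : act H M.X ≫ f.hom = H ◁ f.hom ≫ act H N.X :=
  f.isModHom.smul_hom

variable {H} in
/-- A morphism of `C` that commutes with the actions, as a morphism of `H`-modules. -/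
def homMk {M N : Mod C H} (f : M.X ⟶ N.X) (h : act H M.X ≫ f = H ◁ f ≫ act H N.X) : M ⟶ N :=
  Mod.Hom.mk' f h

variable {H} in
@[simp]
lemma homMk_hom {M N : Mod C H} (f : M.X ⟶ N.X) (h : act H M.X ≫ f = H ◁ f ≫ act H N.X) :
    (homMk f h).hom = f := rfl

variable {H} in
/-- An isomorphism of `C` that commutes with the actions, as an isomorphism of `H`-modules. -/
def isoMk {M N : Mod C H} (f : M.X ≅ N.X) (h : act H M.X ≫ f.hom = H ◁ f.hom ≫ act H N.X) :
    M ≅ N where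
  hom := homMk f.hom h
  inv := homMk f.inv (by
    rw [Iso.comp_inv_eq, Category.assoc, h, ← Category.assoc, ← MonoidalCategory.whiskerLeft_comp]
    simp)
  hom_inv_id := Mod.hom_ext _ _ (by simp)
  inv_hom_id := Mod.hom_ext _ _ (by simp)

variable {H} in
@[simp]
lemma isoMk_hom_hom {M N : Mod C H} (f : M.X ≅ N.X)
    (h : act H M.X ≫ f.hom = H ◁ f.hom ≫ act H N.X) : (isoMk f h).hom.hom = f.hom := rfl

variable {H} in
@[simp]
lemma isoMk_inv_hom {M N : Mod C H} (f : M.X ≅ N.X)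
    (h : act H M.X ≫ f.hom = H ◁ f.hom ≫ act H N.X) : (isoMk f h).inv.hom = f.inv := rfl

end Act

section Modules

variable [BraidedCategory C] (H : C) [BimonObj H]

/-- The diagonal action `h (m ⊗ n) = h₁ m ⊗ h₂ n` on a tensor product of two `H`-modules. -/
def diagAct (M N : C) [ModObj H M] [ModObj H N] : H ⊗ (M ⊗ N) ⟶ M ⊗ N :=
  Δ[H] ▷ (M ⊗ N) ≫ tensorμ H H M N ≫ (act H M ⊗ₘ act H N)

lemma one_diagAct (M N : C) [ModObj H M] [ModObj H N] :
    η[H] ▷ (M ⊗ N) ≫ diagAct H M N = (λ_ (M ⊗ N)).hom := by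
  have h : η[H] ≫ Δ[H] = (λ_ (𝟙_ C)).inv ≫ (η[H] ⊗ₘ η[H]) := by
    rw [BimonObj.one_comul]; rfl
  rw [diagAct, ← comp_whiskerRight_assoc, h, comp_whiskerRight, Category.assoc,
    tensorμ_natural_left_assoc, tensorHom_comp_tensorHom, one_act, one_act,
    ← tensor_left_unitality]

lemma mul_diagAct (M N : C) [ModObj H M] [ModObj H N] :
    μ[H] ▷ (M ⊗ N) ≫ diagAct H M N =
      (α_ H H (M ⊗ N)).hom ≫ H ◁ diagAct H M N ≫ diagAct H M N := by
  have e1 : μ[H] ▷ (M ⊗ N) ≫ diagAct H M N =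
      (Δ[H] ⊗ₘ Δ[H]) ▷ (M ⊗ N) ≫ tensorμ H H H H ▷ (M ⊗ N) ≫ tensorμ (H ⊗ H) (H ⊗ H) M N ≫
        ((α_ H H M).hom ⊗ₘ (α_ H H N).hom) ≫ (H ◁ act H M ⊗ₘ H ◁ act H N) ≫
          (act H M ⊗ₘ act H N) := by
    rw [diagAct, ← comp_whiskerRight_assoc, BimonObj.mul_comul]
    simp only [comp_whiskerRight, Category.assoc]
    rw [tensorμ_natural_left_assoc]
    simp only [tensorHom_comp_tensorHom, mul_act]
  rw [e1, tensor_associativity_assoc]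
  have e2 : H ◁ diagAct H M N ≫ diagAct H M N =
      H ◁ (Δ[H] ▷ (M ⊗ N)) ≫ Δ[H] ▷ ((H ⊗ H) ⊗ (M ⊗ N)) ≫ (H ⊗ H) ◁ tensorμ H H M N ≫
        tensorμ H H (H ⊗ M) (H ⊗ N) ≫ (H ◁ act H M ⊗ₘ H ◁ act H N) ≫
          (act H M ⊗ₘ act H N) := by
    rw [← tensorμ_natural_right_assoc]
    simp only [diagAct, MonoidalCategory.whiskerLeft_comp, Category.assoc]
    rw [whisker_exchange_assoc, whisker_exchange_assoc]
  rw [e2, MonoidalCategory.tensorHom_def]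
  simp only [comp_whiskerRight, Category.assoc]
  rw [associator_naturality_middle_assoc, associator_naturality_left_assoc,
    whisker_exchange_assoc]

/-- The tensor product of two `H`-modules is an `H`-module by the diagonal action. -/
instance tensorModObj (M N : C) [ModObj H M] [ModObj H N] : ModObj H (M ⊗ N) where
  smul := diagAct H M N
  one_smul := one_diagAct H M N
  mul_smul := mul_diagAct H M N

lemma act_tensor (M N : C) [ModObj H M] [ModObj H N] : act H (M ⊗ N) = diagAct H M N := rfl

/-- The trivial action on the unit object, given by the counit of `H`. -/
def unitAct : H ⊗ 𝟙_ C ⟶ 𝟙_ C := ε[H] ▷ 𝟙_ C ≫ (λ_ (𝟙_ C)).hom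

/-- The unit object with the trivial `H`-action. -/
instance unitModObj : ModObj H (𝟙_ C) where
  smul := unitAct H
  one_smul := by
    change η[H] ▷ 𝟙_ C ≫ unitAct H = (λ_ (𝟙_ C)).hom
    rw [unitAct, ← comp_whiskerRight_assoc, BimonObj.one_counit]; simp
  mul_smul := by
    change μ[H] ▷ 𝟙_ C ≫ unitAct H = (α_ H H (𝟙_ C)).hom ≫ H ◁ unitAct H ≫ unitAct H
    have h : μ[H] ≫ ε[H] = (ε[H] ⊗ₘ ε[H]) ≫ (λ_ (𝟙_ C)).hom := by
      rw [BimonObj.mul_counit]; rfl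
    rw [unitAct, ← comp_whiskerRight_assoc, h, MonoidalCategory.tensorHom_def']
    simp only [MonoidalCategory.whiskerLeft_comp, comp_whiskerRight, Category.assoc]
    monoidal

variable {H}

/-- The tensor product of `H`-modules. -/
abbrev tensorMod (M N : Mod C H) : Mod C H := ⟨M.X ⊗ N.X⟩

variable (H) in
/-- The unit `H`-module. -/
abbrev unitMod : Mod C H := ⟨𝟙_ C⟩

lemma act_unit : act H (𝟙_ C) = unitAct H := rfl

lemma diagAct_natural {M M' N N' : Mod C H} (f : M ⟶ M') (g : N ⟶ N') :
    diagAct H M.X N.X ≫ (f.hom ⊗ₘ g.hom) = H ◁ (f.hom ⊗ₘ g.hom) ≫ diagAct H M'.X N'.X := by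
  simp only [diagAct, Category.assoc, tensorHom_comp_tensorHom, act_hom]
  rw [← tensorHom_comp_tensorHom, ← tensorμ_natural_right_assoc, whisker_exchange_assoc]

lemma diagAct_assoc (M N P : Mod C H) :
    diagAct H (M.X ⊗ N.X) P.X ≫ (α_ M.X N.X P.X).hom =
      H ◁ (α_ M.X N.X P.X).hom ≫ diagAct H M.X (N.X ⊗ P.X) := by
  have e1 : diagAct H (M.X ⊗ N.X) P.X ≫ (α_ M.X N.X P.X).hom =
      (Δ[H] ≫ Δ[H] ▷ H) ▷ ((M.X ⊗ N.X) ⊗ P.X) ≫ tensorμ (H ⊗ H) H (M.X ⊗ N.X) P.X ≫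
        tensorμ H H M.X N.X ▷ (H ⊗ P.X) ≫ (α_ (H ⊗ M.X) (H ⊗ N.X) (H ⊗ P.X)).hom ≫
          (act H M.X ⊗ₘ act H N.X ⊗ₘ act H P.X) := by
    have := tensorμ_natural_left Δ[H] (𝟙 H) (M.X ⊗ N.X) P.X
    rw [tensorHom_id] at this
    rw [comp_whiskerRight_assoc, reassoc_of% this, diagAct, act_tensor, diagAct,
      ← associator_naturality]
    simp only [Category.assoc, ← tensorHom_id, tensorHom_comp_tensorHom_assoc]
    simp
  have e2 : H ◁ (α_ M.X N.X P.X).hom ≫ diagAct H M.X (N.X ⊗ P.X) =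
      H ◁ (α_ M.X N.X P.X).hom ≫ (Δ[H] ≫ H ◁ Δ[H]) ▷ (M.X ⊗ N.X ⊗ P.X) ≫
        tensorμ H (H ⊗ H) M.X (N.X ⊗ P.X) ≫ (H ⊗ M.X) ◁ tensorμ H H N.X P.X ≫
          (act H M.X ⊗ₘ act H N.X ⊗ₘ act H P.X) := by
    have := tensorμ_natural_left (𝟙 H) Δ[H] M.X (N.X ⊗ P.X)
    rw [id_tensorHom] at this
    rw [comp_whiskerRight_assoc, reassoc_of% this, diagAct, act_tensor, diagAct]
    simp only [← id_tensorHom, tensorHom_comp_tensorHom]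
    simp
  rw [e1, e2, associator_monoidal_assoc, ComonObj.comul_assoc, MonoidalCategory.tensorHom_def']
  simp only [comp_whiskerRight, Category.assoc]
  simp only [whisker_exchange_assoc]

lemma diagAct_leftUnitor (M : Mod C H) :
    diagAct H (𝟙_ C) M.X ≫ (λ_ M.X).hom = H ◁ (λ_ M.X).hom ≫ act H M.X := by
  have h := tensorμ_natural_left ε[H] (𝟙 H) (𝟙_ C) M.X
  rw [tensorHom_id] at h
  have e : diagAct H (𝟙_ C) M.X ≫ (λ_ M.X).hom =
      (Δ[H] ≫ ε[H] ▷ H) ▷ (𝟙_ C ⊗ M.X) ≫ tensorμ (𝟙_ C) H (𝟙_ C) M.X ≫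
        (λ_ (𝟙_ C)).hom ▷ (H ⊗ M.X) ≫ (λ_ (H ⊗ M.X)).hom ≫ act H M.X := by
    rw [comp_whiskerRight_assoc, reassoc_of% h, diagAct, act_unit, unitAct,
      ← leftUnitor_naturality]
    simp only [← tensorHom_id, ← id_tensorHom, tensorHom_comp_tensorHom_assoc]
    simp
  rw [e, ← leftUnitor_monoidal_assoc, ComonObj.counit_comul, MonoidalCategory.tensorHom_def]
  simp

lemma diagAct_rightUnitor (M : Mod C H) :
    diagAct H M.X (𝟙_ C) ≫ (ρ_ M.X).hom = H ◁ (ρ_ M.X).hom ≫ act H M.X := by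
  have h := tensorμ_natural_left (𝟙 H) ε[H] M.X (𝟙_ C)
  rw [id_tensorHom] at h
  have e : diagAct H M.X (𝟙_ C) ≫ (ρ_ M.X).hom =
      (Δ[H] ≫ H ◁ ε[H]) ▷ (M.X ⊗ 𝟙_ C) ≫ tensorμ H (𝟙_ C) M.X (𝟙_ C) ≫
        (H ⊗ M.X) ◁ (λ_ (𝟙_ C)).hom ≫ (ρ_ (H ⊗ M.X)).hom ≫ act H M.X := by
    rw [comp_whiskerRight_assoc, reassoc_of% h, diagAct, act_unit, unitAct,
      ← rightUnitor_naturality]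
    simp only [← tensorHom_id, ← id_tensorHom, tensorHom_comp_tensorHom_assoc]
    simp
  rw [e, ← rightUnitor_monoidal_assoc, ComonObj.comul_counit, MonoidalCategory.tensorHom_def]
  simp

/-- The category of left modules over a bialgebra is monoidal. -/
instance : MonoidalCategory (Mod C H) where
  tensorObj := tensorMod
  tensorUnit := unitMod H
  tensorHom f g := homMk (f.hom ⊗ₘ g.hom) (diagAct_natural f g)
  whiskerLeft M _ _ f := homMk (M.X ◁ f.hom) (by simpa using! diagAct_natural (𝟙 M) f)
  whiskerRight f N := homMk (f.hom ▷ N.X) (by simpa using! diagAct_natural f (𝟙 N))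
  associator M N P := isoMk (α_ M.X N.X P.X) (diagAct_assoc M N P)
  leftUnitor M := isoMk (λ_ M.X) (diagAct_leftUnitor M)
  rightUnitor M := isoMk (ρ_ M.X) (diagAct_rightUnitor M)
  tensorHom_def f g := Mod.hom_ext _ _ (MonoidalCategory.tensorHom_def f.hom g.hom)
  id_tensorHom_id M N := Mod.hom_ext _ _ (id_tensorHom_id M.X N.X)
  tensorHom_comp_tensorHom f g h k :=
    Mod.hom_ext _ _ (tensorHom_comp_tensorHom f.hom g.hom h.hom k.hom)
  whiskerLeft_id M N := Mod.hom_ext _ _ (whiskerLeft_id M.X N.X)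
  id_whiskerRight M N := Mod.hom_ext _ _ (id_whiskerRight M.X N.X)
  associator_naturality f g h := Mod.hom_ext _ _ (associator_naturality f.hom g.hom h.hom)
  leftUnitor_naturality f := Mod.hom_ext _ _ (leftUnitor_naturality f.hom)
  rightUnitor_naturality f := Mod.hom_ext _ _ (rightUnitor_naturality f.hom)
  pentagon M N P Q := Mod.hom_ext _ _ (pentagon M.X N.X P.X Q.X)
  triangle M N := Mod.hom_ext _ _ (triangle M.X N.X)

/-- The braiding of `C` is `H`-linear: for all left `H`-modules `M` and `N`, the braiding
`M ⊗ N ⟶ N ⊗ M` is a morphism of `H`-modules for the diagonal actions. -/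
class BraidingLinear (H : C) [BimonObj H] : Prop where
  linear (M N : Mod C H) :
    act H (M.X ⊗ N.X) ≫ (β_ M.X N.X).hom = H ◁ (β_ M.X N.X).hom ≫ act H (N.X ⊗ M.X)

/-- If the braiding of `C` is `H`-linear, then it is a braiding on the category of `H`-modules. -/
instance [BraidingLinear H] : BraidedCategory (Mod C H) where
  braiding M N := isoMk (β_ M.X N.X) (BraidingLinear.linear M N)
  braiding_naturality_right M _ _ f :=
    Mod.hom_ext _ _ (BraidedCategory.braiding_naturality_right M.X f.hom)
  braiding_naturality_left f M :=
    Mod.hom_ext _ _ (BraidedCategory.braiding_naturality_left f.hom M.X)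
  hexagon_forward M N P := Mod.hom_ext _ _ (BraidedCategory.hexagon_forward M.X N.X P.X)
  hexagon_reverse M N P := Mod.hom_ext _ _ (BraidedCategory.hexagon_reverse M.X N.X P.X)

end Modules

section Closed

variable [BraidedCategory C] {H : C} [BimonObj H]

attribute [local instance] ModObj.regular

lemma act_regular : act H H = μ[H] := rfl

/-- Auxiliary: the value of the diagonal action of `H` on `H ⊗ H` at the units. -/
lemma diagAct_units :
    (ρ_ H).inv ≫ H ◁ ((λ_ (𝟙_ C)).inv ≫ (η[H] ⊗ₘ η[H])) ≫ diagAct H H H = Δ[H] := by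
  rw [diagAct, whisker_exchange_assoc, MonoidalCategory.whiskerLeft_comp_assoc,
    tensorμ_natural_right_assoc, act_regular, tensorHom_comp_tensorHom, MonObj.mul_one,
    ← tensor_right_unitality, rightUnitor_naturality, Iso.inv_hom_id_assoc]

variable (H) in
/-- If the braiding is `H`-linear, then `H` is cocommutative. -/
lemma comul_braiding [BraidingLinear H] : Δ[H] ≫ (β_ H H).hom = Δ[H] := by
  have h : diagAct H H H ≫ (β_ H H).hom = H ◁ (β_ H H).hom ≫ diagAct H H H :=
    BraidingLinear.linear (Mod.regular H) (Mod.regular H)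
  have h' : ((λ_ (𝟙_ C)).inv ≫ (η[H] ⊗ₘ η[H])) ≫ (β_ H H).hom =
      (λ_ (𝟙_ C)).inv ≫ (η[H] ⊗ₘ η[H]) := by
    rw [Category.assoc, BraidedCategory.braiding_naturality]
    simp [unitors_inv_equal]
  conv_lhs => rw [← diagAct_units]
  simp only [Category.assoc]
  rw [h, ← MonoidalCategory.whiskerLeft_comp_assoc, h', diagAct_units]

variable (H) in
/-- The entwining `h ⊗ m ↦ h₁ m ⊗ h₂`. -/
def entwine (M : C) [ModObj H M] : H ⊗ M ⟶ M ⊗ H :=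
  Δ[H] ▷ M ≫ (α_ H H M).hom ≫ H ◁ (β_ H M).hom ≫ (α_ H M H).inv ≫ act H M ▷ H

lemma diagAct_eq (M X : C) [ModObj H M] [ModObj H X] :
    diagAct H M X =
      (α_ H M X).inv ≫ entwine H M ▷ X ≫ (α_ M H X).hom ≫ M ◁ act H X := by
  simp only [diagAct, entwine, tensorμ, comp_whiskerRight, Category.assoc,
    MonoidalCategory.tensorHom_def]
  monoidal

lemma entwine_eq (M : C) [ModObj H M] :
    entwine H M = H ◁ ((ρ_ M).inv ≫ M ◁ η[H]) ≫ diagAct H M H := by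
  rw [diagAct_eq, act_regular]
  have : H ◁ ((ρ_ M).inv ≫ M ◁ η[H]) ≫ (α_ H M H).inv ≫ entwine H M ▷ H =
      entwine H M ≫ (ρ_ _).inv ≫ (M ⊗ H) ◁ η[H] := by
    simp only [MonoidalCategory.whiskerLeft_comp, Category.assoc]
    rw [associator_inv_naturality_right_assoc, whisker_exchange]
    monoidal
  rw [reassoc_of% this, associator_naturality_right_assoc, ← MonoidalCategory.whiskerLeft_comp,
    MonObj.mul_one]
  monoidal

lemma one_entwine (M : C) [ModObj H M] :
    η[H] ▷ M ≫ entwine H M = (λ_ M).hom ≫ (ρ_ M).inv ≫ M ◁ η[H] := by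
  rw [entwine_eq, ← whisker_exchange_assoc, one_diagAct, leftUnitor_naturality]

lemma mul_entwine (M : C) [ModObj H M] :
    μ[H] ▷ M ≫ entwine H M = (α_ H H M).hom ≫ H ◁ entwine H M ≫ (α_ H M H).inv ≫
      entwine H M ▷ H ≫ (α_ M H H).hom ≫ M ◁ μ[H] := by
  conv_lhs => rw [entwine_eq, ← whisker_exchange_assoc, mul_diagAct]
  have := diagAct_eq (H := H) M H
  rw [act_regular] at this
  rw [← this, associator_naturality_right_assoc, ← MonoidalCategory.whiskerLeft_comp_assoc,
    ← entwine_eq]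

end Closed

section Closed

variable [BraidedCategory C] {H : C} [HopfObj H]

/-- Auxiliary: `h ⊗ m ↦ h₁ ⊗ h₂ m`. -/
def fusion (M : C) [ModObj H M] : H ⊗ M ⟶ H ⊗ M :=
  Δ[H] ▷ M ≫ (α_ H H M).hom ≫ H ◁ act H M

/-- Auxiliary: `h ⊗ m ↦ h₁ ⊗ S(h₂) m`. -/
def fusionInv (M : C) [ModObj H M] : H ⊗ M ⟶ H ⊗ M :=
  Δ[H] ▷ M ≫ (α_ H H M).hom ≫ H ◁ (HopfObj.antipode ▷ M ≫ act H M)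

lemma fusion_aux (f g k : H ⟶ H) (h : Δ[H] ≫ f ▷ H ≫ H ◁ g ≫ μ[H] = k) (M : C) [ModObj H M] :
    Δ[H] ▷ M ≫ (α_ H H M).hom ≫ H ◁ (g ▷ M ≫ act H M) ≫ Δ[H] ▷ M ≫ (α_ H H M).hom ≫
      H ◁ (f ▷ M ≫ act H M) = Δ[H] ▷ M ≫ (α_ H H M).hom ≫ H ◁ (k ▷ M ≫ act H M) := by
  have h1 : H ◁ (g ▷ M ≫ act H M) ≫ Δ[H] ▷ M ≫ (α_ H H M).hom ≫ H ◁ (f ▷ M ≫ act H M) =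
      Δ[H] ▷ (H ⊗ M) ≫ (α_ H H (H ⊗ M)).hom ≫
        H ◁ (f ▷ (H ⊗ M) ≫ H ◁ (g ▷ M) ≫ (α_ H H M).inv ≫ μ[H] ▷ M ≫ act H M) := by
    rw [mul_act, Iso.inv_hom_id_assoc, whisker_exchange_assoc, associator_naturality_right_assoc]
    simp only [← MonoidalCategory.whiskerLeft_comp]
    rw [whisker_exchange_assoc]
    simp only [MonoidalCategory.whiskerLeft_comp, Category.assoc]
  have h2 : f ▷ (H ⊗ M) ≫ H ◁ (g ▷ M) ≫ (α_ H H M).inv ≫ μ[H] ▷ M ≫ act H M =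
      (α_ H H M).inv ≫ (f ▷ H ≫ H ◁ g ≫ μ[H]) ▷ M ≫ act H M := by
    monoidal
  have h3 : Δ[H] ▷ M ≫ (α_ H H M).hom ≫ Δ[H] ▷ (H ⊗ M) ≫ (α_ H H (H ⊗ M)).hom ≫
      H ◁ (α_ H H M).inv = Δ[H] ▷ M ≫ (α_ H H M).hom ≫ H ◁ (Δ[H] ▷ M) := by
    have : Δ[H] ▷ M ≫ (α_ H H M).hom ≫ H ◁ (Δ[H] ▷ M) =
        (Δ[H] ≫ H ◁ Δ[H]) ▷ M ≫ (α_ H (H ⊗ H) M).hom := by monoidal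
    rw [this, ComonObj.comul_assoc]
    monoidal
  rw [h1, h2, MonoidalCategory.whiskerLeft_comp, reassoc_of% h3,
    ← MonoidalCategory.whiskerLeft_comp, ← comp_whiskerRight_assoc, h]

lemma fusion_unit (M : C) [ModObj H M] :
    Δ[H] ▷ M ≫ (α_ H H M).hom ≫ H ◁ ((ε[H] ≫ η[H]) ▷ M ≫ act H M) = 𝟙 _ := by
  rw [comp_whiskerRight, Category.assoc, one_act]
  have : Δ[H] ▷ M ≫ (α_ H H M).hom ≫ H ◁ (ε[H] ▷ M ≫ (λ_ M).hom) =
      (Δ[H] ≫ H ◁ ε[H]) ▷ M ≫ (α_ H (𝟙_ C) M).hom ≫ H ◁ (λ_ M).hom := by monoidal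
  rw [this, ComonObj.comul_counit]
  monoidal

lemma fusion_fusionInv (M : C) [ModObj H M] : fusion M ≫ fusionInv M = 𝟙 (H ⊗ M) := by
  have := fusion_aux (H := H) HopfObj.antipode (𝟙 H) (ε[H] ≫ η[H])
    (by simp) M
  rw [fusion_unit] at this
  simpa [fusion, fusionInv] using this

lemma fusionInv_fusion (M : C) [ModObj H M] : fusionInv M ≫ fusion M = 𝟙 (H ⊗ M) := by
  have := fusion_aux (H := H) (𝟙 H) HopfObj.antipode (ε[H] ≫ η[H])
    (by simp) M
  rw [fusion_unit] at this
  simpa [fusion, fusionInv] using this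

lemma entwine_fusion [BraidingLinear H] (M : C) [ModObj H M] :
    entwine H M = fusion M ≫ (β_ H M).hom := by
  rw [fusion, Category.assoc, Category.assoc, BraidedCategory.braiding_naturality_right,
    BraidedCategory.braiding_tensor_right_hom]
  simp only [Category.assoc, Iso.hom_inv_id_assoc]
  rw [← comp_whiskerRight_assoc, comul_braiding, entwine]

/-- The entwining `h ⊗ m ↦ h₁ m ⊗ h₂` is invertible, with inverse `m ⊗ h ↦ h₁ ⊗ S(h₂) m` (up to
the braiding). -/
def entwineIso [BraidingLinear H] (M : C) [ModObj H M] : H ⊗ M ≅ M ⊗ H where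
  hom := entwine H M
  inv := (β_ H M).inv ≫ fusionInv M
  hom_inv_id := by simp [entwine_fusion, fusion_fusionInv]
  inv_hom_id := by simp [entwine_fusion, reassoc_of% fusionInv_fusion (H := H)]

/-- The morphism `m ⊗ h ⊗ x ↦ h₁ k(S(h₂) m ⊗ x)` associated with a morphism `k : M ⊗ X ⟶ N`. -/
def conjAct [BraidingLinear H] {M X N : C} [ModObj H M] [ModObj H N] (k : M ⊗ X ⟶ N) :
    M ⊗ (H ⊗ X) ⟶ N :=
  (α_ M H X).inv ≫ (entwineIso M).inv ▷ X ≫ (α_ H M X).hom ≫ H ◁ k ≫ act H N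

lemma eq_conjAct_iff [BraidingLinear H] {M X N : C} [ModObj H M] [ModObj H N] (k : M ⊗ X ⟶ N)
    (l : M ⊗ (H ⊗ X) ⟶ N) : l = conjAct k ↔
      (α_ H M X).inv ≫ entwine H M ▷ X ≫ (α_ M H X).hom ≫ l = H ◁ k ≫ act H N := by
  have : entwine H M = (entwineIso M).hom := rfl
  rw [conjAct, this]
  constructor
  · rintro rfl
    simp
  · intro h
    rw [← h]
    simp

lemma conjAct_natural [BraidingLinear H] {M X X' N : C} [ModObj H M] [ModObj H N]
    (f : X ⟶ X') (k : M ⊗ X' ⟶ N) :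
    M ◁ (H ◁ f) ≫ conjAct k = conjAct (M ◁ f ≫ k) := by
  simp only [conjAct, MonoidalCategory.whiskerLeft_comp, Category.assoc]
  rw [associator_inv_naturality_right_assoc, whisker_exchange_assoc,
    associator_naturality_right_assoc]

lemma one_conjAct [BraidingLinear H] {M X N : C} [ModObj H M] [ModObj H N] (k : M ⊗ X ⟶ N) :
    M ◁ (η[H] ▷ X) ≫ conjAct k = M ◁ (λ_ X).hom ≫ k := by
  have h : M ◁ η[H] ≫ (entwineIso (H := H) M).inv = (ρ_ M).hom ≫ (λ_ M).inv ≫ η[H] ▷ M := by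
    rw [Iso.comp_inv_eq]
    change _ = _ ≫ entwine H M
    simp [one_entwine]
  have h' : M ◁ (η[H] ▷ X) ≫ conjAct k = (α_ M (𝟙_ C) X).inv ≫
      (M ◁ η[H] ≫ (entwineIso (H := H) M).inv) ▷ X ≫ (α_ H M X).hom ≫ H ◁ k ≫ act H N := by
    rw [conjAct]; monoidal
  rw [h', h]
  simp only [comp_whiskerRight, Category.assoc, associator_naturality_left_assoc]
  rw [← whisker_exchange_assoc, one_act]
  monoidal

lemma mul_conjAct [BraidingLinear H] {M X N : C} [ModObj H M] [ModObj H N] (k : M ⊗ X ⟶ N) :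
    M ◁ (μ[H] ▷ X) ≫ conjAct k = M ◁ (α_ H H X).hom ≫ conjAct (conjAct k) := by
  have h := mul_entwine (H := H) M
  rw [← cancel_epi (M ◁ (α_ H H X).inv), ← MonoidalCategory.whiskerLeft_comp_assoc,
    ← MonoidalCategory.whiskerLeft_comp_assoc, Iso.inv_hom_id, MonoidalCategory.whiskerLeft_id,
    Category.id_comp, eq_conjAct_iff]
  have h2 : H ◁ conjAct k ≫ act H N =
      (α_ H M (H ⊗ X)).inv ≫ (α_ (H ⊗ M) H X).inv ≫ (α_ H M H).hom ▷ X ≫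
      (H ◁ (entwineIso (H := H) M).inv) ▷ X ≫ (α_ H H M).inv ▷ X ≫
      (μ[H] ▷ M) ▷ X ≫ (α_ H M X).hom ≫ H ◁ k ≫ act H N := by
    rw [associator_naturality_left_assoc, ← whisker_exchange_assoc, mul_act, conjAct]
    monoidal
  rw [h2, ← cancel_epi ((α_ H M (H ⊗ X)).hom), ← cancel_epi ((α_ (H ⊗ M) H X).hom),
    ← cancel_epi ((α_ H M H).inv ▷ X), ← cancel_epi ((H ◁ (entwineIso (H := H) M).hom) ▷ X),
    ← cancel_epi ((α_ H H M).hom ▷ X)]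
  have h3 : (α_ H H M).hom ▷ X ≫ (H ◁ (entwineIso (H := H) M).hom) ▷ X ≫
      (α_ H M H).inv ▷ X ≫ (α_ (H ⊗ M) H X).hom ≫ (α_ H M (H ⊗ X)).hom ≫
      (α_ H M (H ⊗ X)).inv ≫ entwine H M ▷ (H ⊗ X) ≫ (α_ M H (H ⊗ X)).hom ≫
      M ◁ ((α_ H H X).inv ≫ μ[H] ▷ X) ≫ conjAct k =
      ((α_ H H M).hom ≫ H ◁ entwine H M ≫ (α_ H M H).inv ≫
      entwine H M ▷ H ≫ (α_ M H H).hom ≫ M ◁ μ[H]) ▷ X ≫ (entwineIso (H := H) M).inv ▷ X ≫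
        (α_ H M X).hom ≫ H ◁ k ≫ act H N := by
    rw [conjAct]
    change (α_ H H M).hom ▷ X ≫ (H ◁ entwine H M) ▷ X ≫ _ = _
    monoidal
  rw [h3, ← h]
  have h4 : (μ[H] ▷ M ≫ entwine H M) ▷ X ≫ (entwineIso (H := H) M).inv ▷ X =
      (μ[H] ▷ M) ▷ X := by
    rw [← comp_whiskerRight, Category.assoc]
    change (_ ≫ (entwineIso (H := H) M).hom ≫ _) ▷ X = _
    simp
  rw [reassoc_of% h4]
  simp

variable [MonoidalClosed C] [BraidingLinear H]

/-- The inner hom `[M, N]` of two `H`-modules is an `H`-module by `(h f)(m) = h₁ f(S(h₂) m)`. -/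
instance ihomModObj (M N : C) [ModObj H M] [ModObj H N] : ModObj H ((ihom M).obj N) where
  smul := MonoidalClosed.curry (conjAct ((ihom.ev M).app N))
  one_smul := by
    change η[H] ▷ _ ≫ MonoidalClosed.curry _ = (λ_ _).hom
    rw [← MonoidalClosed.curry_natural_left, one_conjAct, MonoidalClosed.curry_eq_iff]
    rfl
  mul_smul := by
    change μ[H] ▷ _ ≫ MonoidalClosed.curry _ = (α_ _ _ _).hom ≫
      H ◁ MonoidalClosed.curry _ ≫ MonoidalClosed.curry _
    rw [← MonoidalClosed.curry_natural_left, ← MonoidalClosed.curry_natural_left,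
      ← MonoidalClosed.curry_natural_left, mul_conjAct, conjAct_natural,
      MonoidalClosed.whiskerLeft_curry_ihom_ev_app]

/-- The inner hom of two `H`-modules. -/
abbrev ihomMod (M N : Mod C H) : Mod C H := ⟨(ihom M.X).obj N.X⟩

lemma act_ihomMod (M N : Mod C H) : act H (ihomMod M N).X =
    MonoidalClosed.curry (conjAct (N := N.X) ((ihom.ev M.X).app N.X)) := rfl

lemma linear_iff_curry (M X N : Mod C H) (f : M.X ⊗ X.X ⟶ N.X) :
    diagAct H M.X X.X ≫ f = H ◁ f ≫ act H N.X ↔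
      act H X.X ≫ MonoidalClosed.curry f = H ◁ MonoidalClosed.curry f ≫ act H (ihomMod M N).X := by
  rw [act_ihomMod, ← MonoidalClosed.curry_natural_left]
  have e : H ◁ MonoidalClosed.curry f ≫ MonoidalClosed.curry (conjAct (N := N.X) ((ihom.ev M.X).app N.X)) =
      MonoidalClosed.curry (conjAct f) := by
    rw [← MonoidalClosed.curry_natural_left, conjAct_natural,
      MonoidalClosed.whiskerLeft_curry_ihom_ev_app]
  refine Iff.trans (b := M.X ◁ act H X.X ≫ f = conjAct f) ?_ ?_
  · rw [eq_conjAct_iff, diagAct_eq]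
    simp only [Category.assoc]
  · exact MonoidalClosed.curry_injective.eq_iff.symm.trans
      ⟨fun h => h.trans e.symm, fun h => h.trans e⟩

lemma linear_uncurry (M X N : Mod C H) (g : X.X ⟶ (ihom M.X).obj N.X)
    (h : act H X.X ≫ g = H ◁ g ≫ act H (ihomMod M N).X) :
    diagAct H M.X X.X ≫ MonoidalClosed.uncurry g =
      H ◁ MonoidalClosed.uncurry g ≫ act H N.X := by
  rw [linear_iff_curry, MonoidalClosed.curry_uncurry]
  exact h

/-- The correspondence between `H`-linear morphisms `M ⊗ X ⟶ N` and `X ⟶ [M, N]`. -/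
def ihomModEquiv (M X N : Mod C H) : (M ⊗ X ⟶ N) ≃ (X ⟶ ihomMod M N) where
  toFun f := homMk (MonoidalClosed.curry f.hom) ((linear_iff_curry M X N f.hom).1 (act_hom f))
  invFun g := homMk (MonoidalClosed.uncurry g.hom) (linear_uncurry M X N g.hom (act_hom g))
  left_inv f := Mod.hom_ext _ _ (MonoidalClosed.uncurry_curry f.hom)
  right_inv g := Mod.hom_ext _ _ (MonoidalClosed.curry_uncurry g.hom)

/-- The category of left modules over a Hopf algebra is closed, if the braiding is linear. -/
instance : MonoidalClosed (Mod C H) where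
  closed M :=
    { rightAdj := Adjunction.rightAdjointOfEquiv (F := tensorLeft M) (ihomModEquiv M)
        (fun _ _ _ f g => Mod.hom_ext _ _ (MonoidalClosed.curry_natural_left f.hom g.hom))
      adj := Adjunction.adjunctionOfEquivRight _ _ }

end Closed

section Flat

/-- An object `X` is flat if `X ⊗ -` preserves equalizers. -/
def Flat (X : C) : Prop :=
  PreservesLimitsOfShape WalkingParallelPair (tensorLeft X)

/-- An object `X` is faithfully flat if `X ⊗ -` preserves and reflects equalizers. -/
def FaithfullyFlat (X : C) : Prop :=
  Flat X ∧ ReflectsLimitsOfShape WalkingParallelPair (tensorLeft X)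

end Flat

section Azumaya

variable [MonoidalClosed C]

/-- The dual `P* = [P, I]` of an object. -/
abbrev dual (P : C) : C := (ihom P).obj (𝟙_ C)

/-- The evaluation `P ⊗ P* ⟶ I`. -/
def evDual (P : C) : P ⊗ dual P ⟶ 𝟙_ C := (ihom.ev P).app (𝟙_ C)

/-- The evaluation `P ⊗ [P, P] ⟶ P`, which makes `P` a module over the algebra `[P, P]`. -/
def evEnd (P : C) : P ⊗ (ihom P).obj P ⟶ P := (ihom.ev P).app P

/-- The canonical morphism `P* ⊗ P ⟶ [P, P]`, `(f ⊗ p) ↦ (x ↦ f(x) p)`. -/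
def dualToEnd (P : C) : dual P ⊗ P ⟶ (ihom P).obj P :=
  MonoidalClosed.curry ((α_ P (dual P) P).inv ≫ evDual P ▷ P ≫ (λ_ P).hom)

/-- An object `P` is finite if the canonical morphism `P* ⊗ P ⟶ [P, P]` is an isomorphism. -/
def IsFinite (P : C) : Prop := IsIso (dualToEnd P)

/-- The action `[P, P] ⊗ P* ⟶ P*` by composition. -/
def endActDual (P : C) : (ihom P).obj P ⊗ dual P ⟶ dual P :=
  MonoidalClosed.curry ((α_ P ((ihom P).obj P) (dual P)).inv ≫ evEnd P ▷ dual P ≫ evDual P)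

lemma evDual_condition (P : C) :
    evEnd P ▷ dual P ≫ evDual P =
      ((α_ P ((ihom P).obj P) (dual P)).hom ≫ P ◁ endActDual P) ≫ evDual P := by
  have h : P ◁ endActDual P ≫ evDual P =
      (α_ P ((ihom P).obj P) (dual P)).inv ≫ evEnd P ▷ dual P ≫ evDual P :=
    MonoidalClosed.whiskerLeft_curry_ihom_ev_app _ _ _
  rw [Category.assoc, h, Iso.hom_inv_id_assoc]

/-- The evaluation `P ⊗ P* ⟶ I` as a cofork on the two morphisms `P ⊗ [P, P] ⊗ P* ⇉ P ⊗ P*` whose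
coequalizer is `P ⊗_{[P, P]} P*`. -/
def evCofork (P : C) : Cofork (evEnd P ▷ dual P)
    ((α_ P ((ihom P).obj P) (dual P)).hom ≫ P ◁ endActDual P) :=
  Cofork.ofπ (evDual P) (evDual_condition P)

/-- An object `P` is faithfully projective if it is finite and the evaluation induces an
isomorphism from the tensor product of `P` and `P*` over `[P, P]` to `I`. -/
structure IsFaithfullyProjective (P : C) : Prop where
  finite : IsFinite P
  coequalizer : Nonempty (IsColimit (evCofork P))

variable [BraidedCategory C]

/-- The action `a ⊗ b ⊗ x ↦ a (x b)` of `A ⊗ Aᵒᵖ` on `A`, where `x` and `b` are interchanged by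
the braiding. -/
def leftEnvAct (A : C) [MonObj A] : (A ⊗ A) ⊗ A ⟶ A :=
  (α_ A A A).hom ≫ A ◁ ((β_ A A).hom ≫ μ[A]) ≫ μ[A]

/-- The right action `x ⊗ a ⊗ b ↦ (a x) b` of `Aᵒᵖ ⊗ A` on `A`, where `x` and `a` are interchanged
by the braiding. -/
def rightEnvAct (A : C) [MonObj A] : A ⊗ (A ⊗ A) ⟶ A :=
  (α_ A A A).inv ≫ ((β_ A A).hom ≫ μ[A]) ▷ A ≫ μ[A]

/-- The morphism `A ⊗ Aᵒᵖ ⟶ [A, A]` that corresponds to the action of `A ⊗ Aᵒᵖ` on `A`. -/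
def leftEnvToEnd (A : C) [MonObj A] : A ⊗ A ⟶ (ihom A).obj A :=
  MonoidalClosed.curry ((β_ A (A ⊗ A)).hom ≫ leftEnvAct A)

/-- The morphism `Aᵒᵖ ⊗ A ⟶ [A, A]` that corresponds to the right action of `Aᵒᵖ ⊗ A` on `A`. -/
def rightEnvToEnd (A : C) [MonObj A] : A ⊗ A ⟶ (ihom A).obj A :=
  MonoidalClosed.curry (rightEnvAct A)

/-- An algebra `A` in a closed braided monoidal category is an Azumaya algebra if it is faithfully
projective and the canonical morphisms `A ⊗ Aᵒᵖ ⟶ [A, A]` and `Aᵒᵖ ⊗ A ⟶ [A, A]` are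
isomorphisms. -/
structure IsAzumayaAlgebra (A : C) [MonObj A] : Prop where
  faithfullyProjective : IsFaithfullyProjective A
  isIso_left : IsIso (leftEnvToEnd A)
  isIso_right : IsIso (rightEnvToEnd A)

/-- The invariants `M^A` of an `A`-bimodule `M` with actions `l` and `r`: the equalizer of the two
morphisms `M ⟶ [A, M]` that correspond to `l : A ⊗ M ⟶ M` and to
`A ⊗ M ⟶ M ⊗ A ⟶ M`, the braiding followed by `r`. -/
def invariants [HasEqualizers C] {A M : C} (l : A ⊗ M ⟶ M) (r : M ⊗ A ⟶ M) : C :=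
  equalizer (MonoidalClosed.curry l) (MonoidalClosed.curry ((β_ A M).hom ≫ r))

/-- The embedding `M^A ⟶ M`. -/
def invariantsι [HasEqualizers C] {A M : C} (l : A ⊗ M ⟶ M) (r : M ⊗ A ⟶ M) :
    invariants l r ⟶ M :=
  equalizer.ι _ _

end Azumaya

section Galois

variable [BraidedCategory C]

/-- `ρ` is a right `H`-comodule structure on `T`. -/
structure IsRightComodule (H : C) [ComonObj H] {T : C} (ρ : T ⟶ T ⊗ H) : Prop where
  counit : ρ ≫ T ◁ ε[H] = (ρ_ T).inv
  coassoc : ρ ≫ T ◁ Δ[H] = ρ ≫ ρ ▷ H ≫ (α_ T H H).hom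

/-- `ρ` makes the algebra `T` a right `H`-comodule algebra: it is a right comodule structure and a
morphism of algebras to the braided tensor product `T ⊗ H`. -/
structure IsComoduleAlgebra (H : C) [BimonObj H] (T : C) [MonObj T] (ρ : T ⟶ T ⊗ H) : Prop where
  comodule : IsRightComodule H ρ
  isMonHom : IsMonHom ρ

/-- The canonical morphism `T ⊗ T ⟶ T ⊗ H`, `x ⊗ y ↦ x y₀ ⊗ y₁`, of an `H`-comodule algebra. -/
def can (H : C) (T : C) [MonObj T] (ρ : T ⟶ T ⊗ H) : T ⊗ T ⟶ T ⊗ H :=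
  T ◁ ρ ≫ (α_ T T H).inv ≫ μ[T] ▷ H

/-- `T` with the coaction `ρ` is an `H`-Galois object: a faithfully flat right `H`-comodule algebra
whose canonical morphism is an isomorphism. -/
structure IsGaloisObject (H : C) [BimonObj H] (T : C) [MonObj T] (ρ : T ⟶ T ⊗ H) : Prop where
  comoduleAlgebra : IsComoduleAlgebra H T ρ
  faithfullyFlat : FaithfullyFlat T
  isIso_can : IsIso (can H T ρ)

end Galois

section Smash

variable [BraidedCategory C] {H : C} [BimonObj H]

/-- The underlying algebra in `C` of an `H`-module algebra, that is, of an algebra in the monoidal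
category of `H`-modules. -/
instance underlyingAlgebra (A : Mod C H) [MonObj A] : MonObj A.X where
  one := (η[A] : 𝟙_ (Mod C H) ⟶ A).hom
  mul := (μ[A] : A ⊗ A ⟶ A).hom
  one_mul := congrArg Mod.Hom.hom (MonObj.one_mul A)
  mul_one := congrArg Mod.Hom.hom (MonObj.mul_one A)
  mul_assoc := congrArg Mod.Hom.hom (MonObj.mul_assoc A)

/-- The underlying object `A ⊗ H` of the smash product `A # H`. -/
abbrev smash (A : Mod C H) : C := A.X ⊗ H

variable (A : Mod C H) [MonObj A]

/-- The multiplication `(a # h) (b # k) = a (h₁ b) # h₂ k` of the smash product. -/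
def smashMul : smash A ⊗ smash A ⟶ smash A :=
  (α_ A.X H (A.X ⊗ H)).hom ≫
    A.X ◁ ((α_ H A.X H).inv ≫ entwine H A.X ▷ H ≫ (α_ A.X H H).hom) ≫
      (α_ A.X A.X (H ⊗ H)).inv ≫ (μ[A.X] ⊗ₘ μ[H])

/-- The unit `1 # 1` of the smash product. -/
def smashOne : 𝟙_ C ⟶ smash A := (λ_ (𝟙_ C)).inv ≫ (η[A.X] ⊗ₘ η[H])

/-- The right `H`-coaction `A ⊗ Δ` on the smash product. -/
def smashCoact : smash A ⟶ smash A ⊗ H := A.X ◁ Δ[H] ≫ (α_ A.X H H).inv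

/-- The morphism `A ⟶ A # H`, `a ↦ a # 1`. -/
def smashIncl : A.X ⟶ smash A := (ρ_ A.X).inv ≫ A.X ◁ η[H]

/-- The left `A`-action on `A # H`, by multiplication with `a # 1` from the left. -/
def smashLeftAct : A.X ⊗ smash A ⟶ smash A := smashIncl A ▷ smash A ≫ smashMul A

/-- The right `A`-action on `A # H`, by multiplication with `a # 1` from the right. -/
def smashRightAct : smash A ⊗ A.X ⟶ smash A := smash A ◁ smashIncl A ≫ smashMul A

variable [MonoidalClosed C] [HasEqualizers C]

/-- The invariants `(A # H)^A`. -/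
def smashInvariants : C := invariants (smashLeftAct A) (smashRightAct A)

/-- The embedding `(A # H)^A ⟶ A # H`. -/
def smashInvariantsι : smashInvariants A ⟶ smash A :=
  invariantsι (smashLeftAct A) (smashRightAct A)

end Smash

end BraidedHopf

end

open BraidedHopf

/-!
Let `B` be an algebra with a morphism from `A`, and let `T` be the centralizer of `A` in `B`. Since
`A ⊗ Aᵒᵖ ≅ [A, A]`, the endomorphisms `x ↦ f(x) 1` of `A` are given by a morphism
`ω : A* ⟶ A ⊗ A`. Its action on `B` takes values in `T`, and it is used like a separability
idempotent to invert the multiplication `A ⊗ T ⟶ B`. For `B = A # H` this yields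
`A ⊗ T ≅ A ⊗ H`, hence `T` is faithfully flat, as `A ⊗ -` is conservative.

The coaction of `B` restricts to `T` because `T ⊗ H` is the centralizer of `A` in `B ⊗ H`. This
uses that `H` is flat, that `A` has a dual, and that the braidings of `A` with `H` are mutually
inverse, which is the linearity of the braiding for a trivial and a regular module.

After tensoring with `A`, the canonical morphism becomes the left `B`-linear morphism
`B ⊗ T ⟶ B ⊗ H`, `b ⊗ t ↦ b t₀ ⊗ t₁`. It factors through the base changes to `B` of two
isomorphisms: `A ⊗ T ≅ A ⊗ H` and `H ⊗ H ≅ H ⊗ H`, `h ⊗ k ↦ h k₁ ⊗ k₂`, the latter being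
invertible by means of the antipode.
-/

noncomputable section

namespace BraidedHopf

variable {C : Type u} [Category.{v} C] [MonoidalCategory C]

/-- The product `x ⊗ y ↦ f(x) g(y)` of two morphisms to an algebra, written `f ⋆ g`. -/
def tensorMul {B X Y : C} [MonObj B] (f : X ⟶ B) (g : Y ⟶ B) : X ⊗ Y ⟶ B := (f ⊗ₘ g) ≫ μ[B]

local notation:85 f:85 " ⋆ " g:86 => tensorMul f g

section TensorMul

variable {A B W X X' Y Y' : C} [MonObj A] [MonObj B]

lemma id_tensorMul_id : 𝟙 B ⋆ 𝟙 B = μ[B] := by simp [tensorMul]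

lemma tensorMul_eq_whiskerRight_comp (f : X ⟶ B) (g : Y ⟶ B) : f ⋆ g = X ◁ g ≫ f ▷ B ≫ μ[B] := by
  rw [tensorMul, MonoidalCategory.tensorHom_def', Category.assoc]

lemma tensorMul_eq_whiskerLeft_comp (f : X ⟶ B) (g : Y ⟶ B) : f ⋆ g = f ▷ Y ≫ B ◁ g ≫ μ[B] := by
  rw [tensorMul, MonoidalCategory.tensorHom_def, Category.assoc]

lemma tensorHom_tensorMul (u : X' ⟶ X) (v : Y' ⟶ Y) (f : X ⟶ B) (g : Y ⟶ B) :
    (u ⊗ₘ v) ≫ f ⋆ g = (u ≫ f) ⋆ (v ≫ g) := by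
  rw [tensorMul, tensorMul, tensorHom_comp_tensorHom_assoc]

lemma whiskerLeft_tensorMul (v : Y' ⟶ Y) (f : X ⟶ B) (g : Y ⟶ B) :
    X ◁ v ≫ f ⋆ g = f ⋆ (v ≫ g) := by
  rw [← id_tensorHom, tensorHom_tensorMul, Category.id_comp]

lemma whiskerRight_tensorMul (u : X' ⟶ X) (f : X ⟶ B) (g : Y ⟶ B) :
    u ▷ Y ≫ f ⋆ g = (u ≫ f) ⋆ g := by
  rw [← tensorHom_id, tensorHom_tensorMul, Category.id_comp]

lemma one_tensorMul (g : Y ⟶ B) : η[B] ⋆ g = (λ_ Y).hom ≫ g := by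
  rw [tensorMul_eq_whiskerRight_comp, MonObj.one_mul, leftUnitor_naturality]

lemma tensorMul_one (f : X ⟶ B) : f ⋆ η[B] = (ρ_ X).hom ≫ f := by
  rw [tensorMul_eq_whiskerLeft_comp, MonObj.mul_one, rightUnitor_naturality]

lemma tensorMul_assoc (f : W ⟶ B) (g : X ⟶ B) (h : Y ⟶ B) :
    f ⋆ g ⋆ h = (α_ W X Y).hom ≫ f ⋆ (g ⋆ h) := by
  simp only [tensorMul]
  rw [← Category.comp_id h, ← tensorHom_comp_tensorHom_assoc, tensorHom_id, MonObj.mul_assoc,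
    associator_naturality_assoc, ← id_tensorHom, tensorHom_comp_tensorHom_assoc]
  simp only [Category.comp_id]

lemma tensorMul_comp (f : X ⟶ A) (g : Y ⟶ A) (i : A ⟶ B) [IsMonHom i] :
    (f ⋆ g) ≫ i = (f ≫ i) ⋆ (g ≫ i) := by
  rw [tensorMul, Category.assoc, IsMonHom.mul_hom, tensorHom_comp_tensorHom_assoc, tensorMul]

lemma mul_comp_eq_tensorMul (i : A ⟶ B) [IsMonHom i] : μ[A] ≫ i = i ⋆ i := by
  rw [IsMonHom.mul_hom, tensorMul]

end TensorMul

section EnvelopingActions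

variable [BraidedCategory C]

/-- `L` is an action of the algebra `A` on `M`, `R` an action of the opposite algebra on `M`, and
these commute up to the braiding. Both are written from the left, so that an `A`-bimodule with
right action `r` has `R = β ≫ r`. -/
structure IsEnvModule {A M : C} [MonObj A] (L R : A ⊗ M ⟶ M) : Prop where
  one_left : η[A] ▷ M ≫ L = (λ_ M).hom
  mul_left : μ[A] ▷ M ≫ L = (α_ A A M).hom ≫ A ◁ L ≫ L
  one_right : η[A] ▷ M ≫ R = (λ_ M).hom
  mul_right : ((β_ A A).hom ≫ μ[A]) ▷ M ≫ R = (α_ A A M).hom ≫ A ◁ R ≫ R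
  right_left : A ◁ L ≫ R =
    (α_ A A M).inv ≫ (β_ A A).hom ▷ M ≫ (α_ A A M).hom ≫ A ◁ R ≫ L

/-- The action `a ⊗ b ⊗ m ↦ a m b` of the enveloping algebra `A ⊗ Aᵒᵖ` on a bimodule `M`. -/
def envAct {A M : C} (L R : A ⊗ M ⟶ M) : (A ⊗ A) ⊗ M ⟶ M :=
  (α_ A A M).hom ≫ A ◁ R ≫ L

lemma leftEnvAct_eq_envAct (A : C) [MonObj A] :
    leftEnvAct A = envAct μ[A] ((β_ A A).hom ≫ μ[A]) := rfl

lemma isEnvModule_of_isMonHom {A B : C} [MonObj A] [MonObj B] (i : A ⟶ B) [IsMonHom i] :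
    IsEnvModule (i ⋆ 𝟙 B) ((β_ A B).hom ≫ 𝟙 B ⋆ i) where
  one_left := by
    rw [whiskerRight_tensorMul, IsMonHom.one_hom, one_tensorMul, Category.comp_id]
  mul_left := by
    rw [whiskerRight_tensorMul, mul_comp_eq_tensorMul, tensorMul_assoc, whiskerLeft_tensorMul,
      Category.comp_id]
  one_right := by
    rw [BraidedCategory.braiding_naturality_left_assoc, whiskerLeft_tensorMul, IsMonHom.one_hom,
      tensorMul_one, Category.comp_id, braiding_rightUnitor]
  mul_right := by
    rw [BraidedCategory.braiding_naturality_left_assoc, whiskerLeft_tensorMul, Category.assoc,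
      mul_comp_eq_tensorMul, ← whiskerLeft_tensorMul,
      ← BraidedCategory.braiding_naturality_left_assoc,
      BraidedCategory.braiding_naturality_right_assoc, whiskerRight_tensorMul, Category.assoc,
      Category.comp_id, ← whiskerRight_tensorMul, tensorMul_assoc,
      BraidedCategory.braiding_tensor_right_hom, BraidedCategory.braiding_tensor_left_hom]
    simp only [Category.assoc, Iso.hom_inv_id_assoc]
  right_left := by
    rw [BraidedCategory.braiding_naturality_right_assoc, whiskerRight_tensorMul, Category.comp_id,
      tensorMul_assoc, whiskerLeft_tensorMul, Category.assoc, Category.comp_id,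
      ← whiskerLeft_tensorMul, BraidedCategory.braiding_tensor_right_hom]
    simp only [Category.assoc, Iso.inv_hom_id_assoc]

lemma isEnvModule_self (A : C) [MonObj A] : IsEnvModule μ[A] ((β_ A A).hom ≫ μ[A]) := by
  simpa only [id_tensorMul_id] using isEnvModule_of_isMonHom (𝟙 A)

namespace IsEnvModule

variable {A M : C} [MonObj A] {L R : A ⊗ M ⟶ M}

lemma one_envAct (h : IsEnvModule L R) :
    ((λ_ (𝟙_ C)).inv ≫ (η[A] ⊗ₘ η[A])) ▷ M ≫ envAct L R = (λ_ M).hom := by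
  calc
    _ = (λ_ (𝟙_ C)).inv ▷ M ≫ (η[A] ▷ 𝟙_ C) ▷ M ≫ (α_ A (𝟙_ C) M).hom ≫
        A ◁ (η[A] ▷ M ≫ R) ≫ L := by
      rw [envAct, MonoidalCategory.tensorHom_def]; monoidal
    _ = η[A] ▷ M ≫ L := by
      rw [h.one_right]; monoidal
    _ = (λ_ M).hom := h.one_left

lemma leftMul_envAct (h : IsEnvModule L R) :
    ((α_ A A A).inv ≫ μ[A] ▷ A) ▷ M ≫ envAct L R =
      (α_ A (A ⊗ A) M).hom ≫ A ◁ envAct L R ≫ L := by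
  calc
    _ = (α_ A (A ⊗ A) M).hom ≫ A ◁ (α_ A A M).hom ≫ (α_ A A (A ⊗ M)).inv ≫
        (A ⊗ A) ◁ R ≫ μ[A] ▷ M ≫ L := by
      rw [envAct, whisker_exchange_assoc]; monoidal
    _ = _ := by
      rw [h.mul_left, envAct]; monoidal

lemma rightMul_envAct (h : IsEnvModule L R) :
    ((α_ A A A).inv ≫ (β_ A A).hom ▷ A ≫ (α_ A A A).hom ≫ A ◁ ((β_ A A).hom ≫ μ[A])) ▷ M ≫
        envAct L R = (α_ A (A ⊗ A) M).hom ≫ A ◁ envAct L R ≫ R := by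
  calc
    _ = (α_ A (A ⊗ A) M).hom ≫ A ◁ (α_ A A M).hom ≫ (α_ A A (A ⊗ M)).inv ≫
        (β_ A A).hom ▷ (A ⊗ M) ≫ (α_ A A (A ⊗ M)).hom ≫ A ◁ (α_ A A M).inv ≫
          A ◁ (((β_ A A).hom ≫ μ[A]) ▷ M ≫ R) ≫ L := by
      rw [envAct]; monoidal
    _ = (α_ A (A ⊗ A) M).hom ≫ A ◁ (α_ A A M).hom ≫ (α_ A A (A ⊗ M)).inv ≫
        ((β_ A A).hom ▷ (A ⊗ M) ≫ (A ⊗ A) ◁ R) ≫ (α_ A A M).hom ≫ A ◁ R ≫ L := by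
      rw [h.mul_right]; monoidal
    _ = (α_ A (A ⊗ A) M).hom ≫ A ◁ (α_ A A M).hom ≫ A ◁ A ◁ R ≫ A ◁ L ≫ R := by
      rw [← whisker_exchange, h.right_left]; monoidal
    _ = _ := by
      rw [envAct]; monoidal

lemma whiskerLeft_comp_right (h : IsEnvModule L R) {T : C} (j : T ⟶ M)
    (hj : A ◁ j ≫ L = A ◁ j ≫ R) :
    A ◁ (A ◁ j ≫ L) ≫ R = (α_ A A T).inv ≫ ((β_ A A).hom ≫ μ[A]) ▷ T ≫ A ◁ j ≫ L := by
  calc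
    _ = (α_ A A T).inv ≫ ((A ⊗ A) ◁ j ≫ (β_ A A).hom ▷ M) ≫ (α_ A A M).hom ≫ A ◁ R ≫ L := by
      rw [MonoidalCategory.whiskerLeft_comp_assoc, h.right_left]; monoidal
    _ = (α_ A A T).inv ≫ (β_ A A).hom ▷ T ≫ (α_ A A T).hom ≫ A ◁ (A ◁ j ≫ R) ≫ L := by
      rw [whisker_exchange]; monoidal
    _ = (α_ A A T).inv ≫ (β_ A A).hom ▷ T ≫ (A ⊗ A) ◁ j ≫ μ[A] ▷ M ≫ L := by
      rw [← hj, h.mul_left]; monoidal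
    _ = _ := by
      rw [whisker_exchange_assoc, comp_whiskerRight_assoc]

lemma envAct_whiskerLeft_comp (h : IsEnvModule L R) {T : C} (j : T ⟶ M)
    (hj : A ◁ j ≫ L = A ◁ j ≫ R) :
    (A ⊗ A) ◁ (A ◁ j ≫ L) ≫ envAct L R =
      (α_ (A ⊗ A) A T).inv ≫ leftEnvAct A ▷ T ≫ A ◁ j ≫ L := by
  calc
    _ = (α_ A A (A ⊗ T)).hom ≫ A ◁ (A ◁ (A ◁ j ≫ L) ≫ R) ≫ L := by
      rw [envAct]; monoidal
    _ = (α_ A A (A ⊗ T)).hom ≫ A ◁ (α_ A A T).inv ≫ A ◁ ((β_ A A).hom ≫ μ[A]) ▷ T ≫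
        A ◁ A ◁ j ≫ A ◁ L ≫ L := by
      rw [h.whiskerLeft_comp_right j hj]; monoidal
    _ = (α_ A A (A ⊗ T)).hom ≫ A ◁ (α_ A A T).inv ≫ A ◁ ((β_ A A).hom ≫ μ[A]) ▷ T ≫
        (α_ A A T).inv ≫ (A ⊗ A) ◁ j ≫ μ[A] ▷ M ≫ L := by
      rw [h.mul_left]; monoidal
    _ = _ := by
      rw [whisker_exchange_assoc, leftEnvAct]; monoidal

end IsEnvModule

end EnvelopingActions

section Separability

variable [BraidedCategory C]

/-- A morphism `ω : D ⟶ A ⊗ A` from a dual `D` of `A` which represents the endomorphisms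
`x ↦ f(x) 1` of `A` by elements of the enveloping algebra, where that algebra acts faithfully on
`A`. It plays the role of a separability idempotent. -/
structure IsEnvSection {A D : C} [MonObj A] [ExactPairing A D] (ω : D ⟶ A ⊗ A) : Prop where
  act : ω ▷ A ≫ leftEnvAct A = ε_ A D ≫ η[A]
  faithful {X : C} (f g : X ⟶ A ⊗ A) (h : f ▷ A ≫ leftEnvAct A = g ▷ A ≫ leftEnvAct A) : f = g

namespace IsEnvSection

variable {A D : C} [MonObj A] [ExactPairing A D] {ω : D ⟶ A ⊗ A}

lemma leftMul_eq_rightMul (hω : IsEnvSection ω) :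
    A ◁ ω ≫ (α_ A A A).inv ≫ μ[A] ▷ A =
      A ◁ ω ≫ (α_ A A A).inv ≫ (β_ A A).hom ▷ A ≫ (α_ A A A).hom ≫
        A ◁ ((β_ A A).hom ≫ μ[A]) := by
  apply hω.faithful
  have act_one (f : A ⊗ (A ⊗ A) ⟶ A ⊗ A) (K : A ⊗ A ⟶ A)
      (hf : f ▷ A ≫ leftEnvAct A = (α_ A (A ⊗ A) A).hom ≫ A ◁ leftEnvAct A ≫ K) :
      (A ◁ ω ≫ f) ▷ A ≫ leftEnvAct A =
        (α_ A D A).hom ≫ A ◁ ε_ A D ≫ A ◁ η[A] ≫ K := by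
    rw [comp_whiskerRight_assoc, hf, associator_naturality_middle_assoc,
      ← MonoidalCategory.whiskerLeft_comp_assoc, hω.act, MonoidalCategory.whiskerLeft_comp_assoc]
  rw [act_one _ _ (isEnvModule_self A).leftMul_envAct,
    act_one _ _ (isEnvModule_self A).rightMul_envAct, MonObj.mul_one,
    BraidedCategory.braiding_naturality_right_assoc, MonObj.one_mul, braiding_leftUnitor]

lemma coev_leftMul (hω : IsEnvSection ω) :
    η_ A D ≫ A ◁ ω ≫ (α_ A A A).inv ≫ μ[A] ▷ A = (λ_ (𝟙_ C)).inv ≫ (η[A] ⊗ₘ η[A]) := by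
  apply hω.faithful
  rw [leftEnvAct_eq_envAct, (isEnvModule_self A).one_envAct, comp_whiskerRight_assoc,
    comp_whiskerRight_assoc, (isEnvModule_self A).leftMul_envAct,
    associator_naturality_middle_assoc, ← MonoidalCategory.whiskerLeft_comp_assoc,
    ← leftEnvAct_eq_envAct, hω.act, MonoidalCategory.whiskerLeft_comp_assoc, MonObj.mul_one,
    ExactPairing.evaluation_coevaluation_assoc, Iso.inv_hom_id, Category.comp_id]

variable {M T : C} {L R : A ⊗ M ⟶ M}

lemma left_eq_right (hω : IsEnvSection ω) (h : IsEnvModule L R) :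
    A ◁ (ω ▷ M ≫ envAct L R) ≫ L = A ◁ (ω ▷ M ≫ envAct L R) ≫ R := by
  have comp_envAct (f : A ⊗ (A ⊗ A) ⟶ A ⊗ A) (K : A ⊗ M ⟶ M)
      (hf : f ▷ M ≫ envAct L R = (α_ A (A ⊗ A) M).hom ≫ A ◁ envAct L R ≫ K) :
      A ◁ (ω ▷ M ≫ envAct L R) ≫ K = (α_ A D M).inv ≫ (A ◁ ω ≫ f) ▷ M ≫ envAct L R := by
    rw [comp_whiskerRight_assoc, hf]
    monoidal
  rw [comp_envAct _ _ h.leftMul_envAct, hω.leftMul_eq_rightMul, ← comp_envAct _ _ h.rightMul_envAct]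

lemma whiskerLeft_comp_retraction (hω : IsEnvSection ω) (h : IsEnvModule L R) (j : T ⟶ M) [Mono j]
    (hj : A ◁ j ≫ L = A ◁ j ≫ R) (k : D ⊗ M ⟶ T) (hk : k ≫ j = ω ▷ M ≫ envAct L R) :
    D ◁ (A ◁ j ≫ L) ≫ k = (α_ D A T).inv ≫ ε_ A D ▷ T ≫ (λ_ T).hom := by
  rw [← cancel_mono j, Category.assoc, hk, whisker_exchange_assoc, h.envAct_whiskerLeft_comp j hj,
    associator_inv_naturality_left_assoc, ← comp_whiskerRight_assoc, hω.act,
    comp_whiskerRight_assoc, ← whisker_exchange_assoc, h.one_left]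
  simp only [Category.assoc, leftUnitor_naturality]

lemma tensorLeftHomEquiv_envAct (hω : IsEnvSection ω) (h : IsEnvModule L R) :
    tensorLeftHomEquiv M A D M (ω ▷ M ≫ envAct L R) ≫ L = 𝟙 M := by
  calc
    _ = (λ_ M).inv ≫ (η_ A D ≫ A ◁ ω) ▷ M ≫ ((α_ A (A ⊗ A) M).hom ≫ A ◁ envAct L R ≫ L) := by
      rw [tensorLeftHomEquiv, Equiv.coe_fn_mk]; monoidal
    _ = (λ_ M).inv ≫ (η_ A D ≫ A ◁ ω ≫ (α_ A A A).inv ≫ μ[A] ▷ A) ▷ M ≫ envAct L R := by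
      rw [← h.leftMul_envAct]; monoidal
    _ = 𝟙 M := by
      rw [hω.coev_leftMul, h.one_envAct, Iso.inv_hom_id]

/-- If `j : T ⟶ M` is the embedding of the invariants of a bimodule, then `ω` acts on `M` through
a morphism to `T`, and the transpose of that morphism is inverse to `a ⊗ t ↦ a t`. -/
lemma isIso_whiskerLeft_comp (hω : IsEnvSection ω) (h : IsEnvModule L R) (j : T ⟶ M) [Mono j]
    (hj : A ◁ j ≫ L = A ◁ j ≫ R) (k : D ⊗ M ⟶ T) (hk : k ≫ j = ω ▷ M ≫ envAct L R) :
    IsIso (A ◁ j ≫ L) := by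
  refine ⟨tensorLeftHomEquiv M A D T k, ?_, ?_⟩
  · apply (tensorLeftHomEquiv _ A D T).symm.injective
    rw [tensorLeftHomEquiv_symm_naturality, Equiv.symm_apply_apply,
      hω.whiskerLeft_comp_retraction h j hj k hk]
    simp [tensorLeftHomEquiv]
  · rw [← Category.assoc, ← tensorLeftHomEquiv_naturality, hk, hω.tensorLeftHomEquiv_envAct h]

end IsEnvSection

end Separability

section Finite

variable [MonoidalClosed C]

lemma IsFinite.exists_coev {P : C} (h : IsFinite P) :
    ∃ c : 𝟙_ C ⟶ dual P ⊗ P,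
      P ◁ c ≫ (α_ P (dual P) P).inv ≫ evDual P ▷ P = (ρ_ P).hom ≫ (λ_ P).inv := by
  have : IsIso (dualToEnd P) := h
  have ev_dualToEnd : P ◁ dualToEnd P ≫ (ihom.ev P).app P =
      (α_ P (dual P) P).inv ≫ evDual P ▷ P ≫ (λ_ P).hom :=
    MonoidalClosed.whiskerLeft_curry_ihom_ev_app _ _ _
  refine ⟨MonoidalClosed.curry (ρ_ P).hom ≫ inv (dualToEnd P), ?_⟩
  rw [← cancel_mono (λ_ P).hom]
  simp only [Category.assoc, Iso.inv_hom_id, Category.comp_id]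
  rw [← ev_dualToEnd, ← MonoidalCategory.whiskerLeft_comp_assoc, Category.assoc,
    IsIso.inv_hom_id, Category.comp_id, MonoidalClosed.whiskerLeft_curry_ihom_ev_app]

lemma coev_dual_of_coev {P : C} (c : 𝟙_ C ⟶ dual P ⊗ P)
    (hc : P ◁ c ≫ (α_ P (dual P) P).inv ≫ evDual P ▷ P = (ρ_ P).hom ≫ (λ_ P).inv) :
    c ▷ dual P ≫ (α_ (dual P) P (dual P)).hom ≫ dual P ◁ evDual P =
      (λ_ (dual P)).hom ≫ (ρ_ (dual P)).inv := by
  rw [← cancel_mono (ρ_ _).hom]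
  apply MonoidalClosed.uncurry_injective
  rw [MonoidalClosed.uncurry_eq, MonoidalClosed.uncurry_eq]
  change P ◁ _ ≫ evDual P = P ◁ _ ≫ evDual P
  calc
    _ = (α_ P (𝟙_ C) (dual P)).inv ≫ (P ◁ c ≫ (α_ P (dual P) P).inv) ▷ dual P ≫
        (α_ (P ⊗ dual P) P (dual P)).hom ≫
          ((P ⊗ dual P) ◁ evDual P ≫ evDual P ▷ 𝟙_ C) ≫ (ρ_ (𝟙_ C)).hom := by
      monoidal
    _ = (α_ P (𝟙_ C) (dual P)).inv ≫
        (P ◁ c ≫ (α_ P (dual P) P).inv ≫ evDual P ▷ P) ▷ dual P ≫ (α_ (𝟙_ C) P (dual P)).hom ≫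
          𝟙_ C ◁ evDual P ≫ (ρ_ (𝟙_ C)).hom := by
      rw [whisker_exchange]; monoidal
    _ = _ := by
      rw [hc]; monoidal

/-- A finite object has the dual `[P, I]`. -/
abbrev IsFinite.exactPairing {P : C} (h : IsFinite P) : ExactPairing (dual P) P where
  coevaluation' := h.exists_coev.choose
  evaluation' := evDual P
  coevaluation_evaluation' := h.exists_coev.choose_spec
  evaluation_coevaluation' := coev_dual_of_coev _ h.exists_coev.choose_spec

variable [BraidedCategory C]

/-- The dual of a finite object is also a dual on the other side, here by means of the inverse of
the braiding: its evaluation is `β⁻¹ ≫ evDual P`. -/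
abbrev IsFinite.exactPairingSwap {P : C} (h : IsFinite P) : ExactPairing P (dual P) :=
  letI := h.exactPairing
  @BraidedCategory.exactPairing_swap C _ _ (reverseBraiding C) (dual P) P _

lemma whiskerLeft_comp_leftEnvToEnd_ev {A X : C} [MonObj A] (f : X ⟶ A ⊗ A) :
    A ◁ (f ≫ leftEnvToEnd A) ≫ (ihom.ev A).app A = (β_ A X).hom ≫ f ▷ A ≫ leftEnvAct A := by
  rw [MonoidalCategory.whiskerLeft_comp_assoc, leftEnvToEnd,
    MonoidalClosed.whiskerLeft_curry_ihom_ev_app,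
    BraidedCategory.braiding_naturality_right_assoc]

lemma IsFinite.exists_isEnvSection {A : C} [MonObj A] (hA : IsFinite A)
    (h : IsIso (leftEnvToEnd A)) :
    letI := hA.exactPairingSwap
    ∃ ω : dual A ⟶ A ⊗ A, IsEnvSection ω := by
  let := hA.exactPairingSwap
  refine ⟨MonoidalClosed.curry (evDual A ≫ η[A]) ≫ inv (leftEnvToEnd A), ?_, ?_⟩
  · have evaluation_eq : ε_ A (dual A) = (β_ A (dual A)).inv ≫ evDual A := rfl
    rw [← cancel_epi (β_ A (dual A)).hom, ← whiskerLeft_comp_leftEnvToEnd_ev, Category.assoc,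
      IsIso.inv_hom_id, Category.comp_id, MonoidalClosed.whiskerLeft_curry_ihom_ev_app,
      evaluation_eq, Category.assoc, Iso.hom_inv_id_assoc]
  · intro X f g hfg
    rw [← cancel_mono (leftEnvToEnd A)]
    apply MonoidalClosed.uncurry_injective
    rw [MonoidalClosed.uncurry_eq, MonoidalClosed.uncurry_eq, whiskerLeft_comp_leftEnvToEnd_ev,
      whiskerLeft_comp_leftEnvToEnd_ev, hfg]

end Finite

section Centralizer

variable {A B T : C} [MonObj B]

/-- The algebra structure on a subobject `j : T ⟶ B` of an algebra which contains the unit and is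
closed under multiplication. -/
abbrev monObjOfMono (j : T ⟶ B) [Mono j] (e : 𝟙_ C ⟶ T) (m : T ⊗ T ⟶ T)
    (he : e ≫ j = η[B]) (hm : m ≫ j = j ⋆ j) : MonObj T where
  one := e
  mul := m
  one_mul := by
    rw [← cancel_mono j, Category.assoc, hm, whiskerRight_tensorMul, he, one_tensorMul]
  mul_one := by
    rw [← cancel_mono j, Category.assoc, hm, whiskerLeft_tensorMul, he, tensorMul_one]
  mul_assoc := by
    rw [← cancel_mono j]
    simp only [Category.assoc, hm]
    rw [whiskerRight_tensorMul, whiskerLeft_tensorMul, hm, tensorMul_assoc]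

variable [BraidedCategory C]

/-- The morphism `f` to the algebra `B` commutes with `i : A ⟶ B`: `i(a) f(x) = f(x) i(a)`, where
`a` and `x` are interchanged by the braiding. -/
def Centralizes {X : C} (i : A ⟶ B) (f : X ⟶ B) : Prop := i ⋆ f = (β_ A X).hom ≫ f ⋆ i

variable {i : A ⟶ B}

lemma centralizes_iff_whiskerLeft_comp {X : C} (f : X ⟶ B) :
    Centralizes i f ↔ A ◁ f ≫ i ⋆ 𝟙 B = A ◁ f ≫ (β_ A B).hom ≫ 𝟙 B ⋆ i := by
  rw [whiskerLeft_tensorMul, Category.comp_id, BraidedCategory.braiding_naturality_right_assoc,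
    whiskerRight_tensorMul, Category.comp_id, Centralizes]

lemma centralizes_one (i : A ⟶ B) : Centralizes i η[B] := by
  rw [Centralizes, tensorMul_one, one_tensorMul, braiding_leftUnitor_assoc]

lemma Centralizes.mul {X Y : C} {f : X ⟶ B} {g : Y ⟶ B} (hf : Centralizes i f)
    (hg : Centralizes i g) : Centralizes i (f ⋆ g) := by
  calc
    i ⋆ (f ⋆ g) = (α_ A X Y).inv ≫ i ⋆ f ⋆ g := by
      rw [tensorMul_assoc, Iso.inv_hom_id_assoc]
    _ = (α_ A X Y).inv ≫ (β_ A X).hom ▷ Y ≫ (α_ X A Y).hom ≫ f ⋆ (i ⋆ g) := by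
      rw [hf, ← whiskerRight_tensorMul, tensorMul_assoc]
    _ = (α_ A X Y).inv ≫ (β_ A X).hom ▷ Y ≫ (α_ X A Y).hom ≫ X ◁ (β_ A Y).hom ≫
        (α_ X Y A).inv ≫ f ⋆ g ⋆ i := by
      rw [hg, ← whiskerLeft_tensorMul, tensorMul_assoc, Iso.inv_hom_id_assoc]
    _ = (β_ A (X ⊗ Y)).hom ≫ f ⋆ g ⋆ i := by
      rw [BraidedCategory.braiding_tensor_right_hom]
      simp only [Category.assoc]

lemma Centralizes.comp {X B' : C} [MonObj B'] {f : X ⟶ B} (hf : Centralizes i f) (p : B ⟶ B')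
    [IsMonHom p] : Centralizes (i ≫ p) (f ≫ p) := by
  rw [Centralizes, ← tensorMul_comp, hf, Category.assoc, tensorMul_comp]

/-- `j : T ⟶ B` is the embedding of the centralizer of `i : A ⟶ B`: the largest subobject which
commutes with `i`. -/
structure IsCentralizer (i : A ⟶ B) (j : T ⟶ B) : Prop where
  mono : Mono j
  centralizes : Centralizes i j
  exists_lift {X : C} (f : X ⟶ B) (hf : Centralizes i f) : ∃ g : X ⟶ T, g ≫ j = f

namespace IsCentralizer

variable {j : T ⟶ B}

/-- The centralizer of a morphism is a subalgebra. -/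
abbrev monObj (h : IsCentralizer i j) : MonObj T :=
  have := h.mono
  monObjOfMono j (h.exists_lift _ (centralizes_one i)).choose
    (h.exists_lift _ (h.centralizes.mul h.centralizes)).choose
    (h.exists_lift _ (centralizes_one i)).choose_spec
    (h.exists_lift _ (h.centralizes.mul h.centralizes)).choose_spec

lemma isMonHom (h : IsCentralizer i j) :
    letI := h.monObj
    IsMonHom j :=
  letI := h.monObj
  { one_hom := (h.exists_lift _ (centralizes_one i)).choose_spec
    mul_hom := (h.exists_lift _ (h.centralizes.mul h.centralizes)).choose_spec }

variable [MonObj A] [IsMonHom i] [MonoidalClosed C]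

lemma isIso_tensorMul (h : IsCentralizer i j) (hA : IsFinite A) (hl : IsIso (leftEnvToEnd A)) :
    IsIso (i ⋆ j) := by
  have := h.mono
  let := hA.exactPairingSwap
  obtain ⟨ω, hω⟩ := hA.exists_isEnvSection hl
  have hB := isEnvModule_of_isMonHom i
  obtain ⟨k, hk⟩ :=
    h.exists_lift _ ((centralizes_iff_whiskerLeft_comp _).2 (hω.left_eq_right hB))
  have key := hω.isIso_whiskerLeft_comp hB j
    ((centralizes_iff_whiskerLeft_comp j).1 h.centralizes) k hk
  rwa [whiskerLeft_tensorMul, Category.comp_id] at key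

end IsCentralizer

lemma isCentralizer_invariantsι [MonoidalClosed C] [HasEqualizers C] (i : A ⟶ B) :
    IsCentralizer i (invariantsι (i ▷ B ≫ μ[B]) (B ◁ i ≫ μ[B])) := by
  have centralizes_iff {X : C} (f : X ⟶ B) : Centralizes i f ↔
      f ≫ MonoidalClosed.curry (i ▷ B ≫ μ[B]) =
        f ≫ MonoidalClosed.curry ((β_ A B).hom ≫ B ◁ i ≫ μ[B]) := by
    rw [← MonoidalClosed.curry_natural_left, ← MonoidalClosed.curry_natural_left,
      MonoidalClosed.curry_injective.eq_iff, centralizes_iff_whiskerLeft_comp]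
    simp only [tensorMul, tensorHom_id, id_tensorHom]
  exact
    { mono := inferInstanceAs (Mono (equalizer.ι _ _))
      centralizes := (centralizes_iff _).2 (equalizer.condition _ _)
      exists_lift f hf :=
        ⟨equalizer.lift f ((centralizes_iff f).1 hf), equalizer.lift_ι _ _⟩ }

end Centralizer

section TwistedTensor

variable {A H : C}

variable (A H) in
/-- The morphism `A ⟶ A ⊗ H`, `a ↦ a ⊗ 1`. -/
def tensorInl [MonObj H] : A ⟶ A ⊗ H := (ρ_ A).inv ≫ A ◁ η[H]

variable (A H) in
/-- The morphism `H ⟶ A ⊗ H`, `h ↦ 1 ⊗ h`. -/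
def tensorInr [MonObj A] : H ⟶ A ⊗ H := (λ_ H).inv ≫ η[A] ▷ H

lemma tensorInl_comp_tensorMul {E : C} [MonObj H] [MonObj E] (f : A ⟶ E) (g : H ⟶ E)
    [IsMonHom g] :
    tensorInl A H ≫ f ⋆ g = f := by
  rw [tensorInl, Category.assoc, whiskerLeft_tensorMul, IsMonHom.one_hom, tensorMul_one,
    Iso.inv_hom_id_assoc]

lemma tensorInr_comp_tensorMul {E : C} [MonObj A] [MonObj E] (f : A ⟶ E) (g : H ⟶ E)
    [IsMonHom f] :
    tensorInr A H ≫ f ⋆ g = g := by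
  rw [tensorInr, Category.assoc, whiskerRight_tensorMul, IsMonHom.one_hom, one_tensorMul,
    Iso.inv_hom_id_assoc]

/-- The action `x ⊗ (a ⊗ h) ↦ (x a) h` of `A ⊗ H` defined by actions of `A` and of `H`. -/
def tensorAct {E : C} (p : E ⊗ A ⟶ E) (q : E ⊗ H ⟶ E) : E ⊗ (A ⊗ H) ⟶ E :=
  (α_ E A H).inv ≫ p ▷ H ≫ q

variable (ψ : H ⊗ A ⟶ A ⊗ H)

/-- The right action `(a ⊗ h) b = a ψ(h ⊗ b)` of `A` on `A ⊗ H` defined by a distributive law. -/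
def twistAct [MonObj A] : (A ⊗ H) ⊗ A ⟶ A ⊗ H :=
  (α_ A H A).hom ≫ A ◁ ψ ≫ (α_ A A H).inv ≫ μ[A] ▷ H

/-- The twisted tensor product of two algebras: the object `A ⊗ H` with the multiplication defined
by the distributive law `ψ`. The type synonym keeps this algebra structure apart from that of the
braided tensor product. -/
def twistTensor (_ : H ⊗ A ⟶ A ⊗ H) : C := A ⊗ H

/-- The embedding of `A` in a twisted tensor product. -/
def twistInl [MonObj H] : A ⟶ twistTensor ψ := tensorInl A H

/-- The embedding of `H` in a twisted tensor product. -/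
def twistInr [MonObj A] : H ⟶ twistTensor ψ := tensorInr A H

variable [MonObj A] [MonObj H]

lemma one_comp_tensorInl : η[A] ≫ tensorInl A H = (λ_ (𝟙_ C)).inv ≫ (η[A] ⊗ₘ η[H]) := by
  rw [tensorInl, MonoidalCategory.tensorHom_def]
  monoidal

lemma one_comp_tensorInr : η[H] ≫ tensorInr A H = (λ_ (𝟙_ C)).inv ≫ (η[A] ⊗ₘ η[H]) := by
  rw [tensorInr, MonoidalCategory.tensorHom_def']
  monoidal

/-- A distributive law between two algebras, also known as an entwining of algebras: the data for
an associative multiplication `(a ⊗ h) (b ⊗ k) = a ψ(h ⊗ b) k` on `A ⊗ H`. -/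
class IsDistributiveLaw : Prop where
  one_left : η[H] ▷ A ≫ ψ = (λ_ A).hom ≫ tensorInl A H
  one_right : H ◁ η[A] ≫ ψ = (ρ_ H).hom ≫ tensorInr A H
  mul_left : μ[H] ▷ A ≫ ψ = (α_ H H A).hom ≫ H ◁ ψ ≫ (α_ H A H).inv ≫
    ψ ▷ H ≫ (α_ A H H).hom ≫ A ◁ μ[H]
  mul_right : H ◁ μ[A] ≫ ψ = (α_ H A A).inv ≫ ψ ▷ A ≫ (α_ A H A).hom ≫
    A ◁ ψ ≫ (α_ A A H).inv ≫ μ[A] ▷ H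

/-- Right actions `p` of `A` and `q` of `H` on `E` that satisfy the exchange law which makes `E` a
right module over the twisted tensor product of `A` and `H`. -/
structure IsTwistModule {E : C} (p : E ⊗ A ⟶ E) (q : E ⊗ H ⟶ E) : Prop where
  left_one : E ◁ η[A] ≫ p = (ρ_ E).hom
  left_mul : E ◁ μ[A] ≫ p = (α_ E A A).inv ≫ p ▷ A ≫ p
  right_one : E ◁ η[H] ≫ q = (ρ_ E).hom
  right_mul : E ◁ μ[H] ≫ q = (α_ E H H).inv ≫ q ▷ H ≫ q
  right_left : q ▷ A ≫ p = (α_ E H A).hom ≫ E ◁ ψ ≫ (α_ E A H).inv ≫ p ▷ H ≫ q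

/-- The multiplication `(a ⊗ h) (b ⊗ k) = a ψ(h ⊗ b) k` on `A ⊗ H` defined by a distributive
law. -/
def twistMul : (A ⊗ H) ⊗ (A ⊗ H) ⟶ A ⊗ H :=
  (α_ A H (A ⊗ H)).hom ≫ A ◁ ((α_ H A H).inv ≫ ψ ▷ H ≫ (α_ A H H).hom) ≫
    (α_ A A (H ⊗ H)).inv ≫ (μ[A] ⊗ₘ μ[H])

lemma twistMul_eq_tensorAct :
    twistMul ψ = tensorAct (twistAct ψ) ((α_ A H H).hom ≫ A ◁ μ[H]) := by
  rw [twistMul, tensorAct, twistAct, MonoidalCategory.tensorHom_def]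
  monoidal

variable {ψ}

namespace IsTwistModule

variable {E : C} {p : E ⊗ A ⟶ E} {q : E ⊗ H ⟶ E}

lemma tensorInl_act (h : IsTwistModule ψ p q) : E ◁ tensorInl A H ≫ tensorAct p q = p := by
  calc
    _ = (ρ_ (E ⊗ A)).inv ≫ ((E ⊗ A) ◁ η[H] ≫ p ▷ H) ≫ q := by
      rw [tensorInl, tensorAct]; monoidal
    _ = (ρ_ (E ⊗ A)).inv ≫ p ▷ 𝟙_ C ≫ E ◁ η[H] ≫ q := by
      rw [whisker_exchange, Category.assoc]
    _ = p := by
      rw [h.right_one, rightUnitor_naturality, Iso.inv_hom_id_assoc]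

lemma tensorInr_act (h : IsTwistModule ψ p q) : E ◁ tensorInr A H ≫ tensorAct p q = q := by
  calc
    _ = (ρ_ E).inv ▷ H ≫ (E ◁ η[A] ≫ p) ▷ H ≫ q := by
      rw [tensorInr, tensorAct]; monoidal
    _ = q := by
      rw [h.left_one, inv_hom_whiskerRight_assoc]

lemma one_act (h : IsTwistModule ψ p q) :
    E ◁ (η[A] ≫ tensorInl A H) ≫ tensorAct p q = (ρ_ E).hom := by
  rw [MonoidalCategory.whiskerLeft_comp_assoc, h.tensorInl_act, h.left_one]

lemma mul_act (h : IsTwistModule ψ p q) :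
    E ◁ twistMul ψ ≫ tensorAct p q =
      (α_ E (A ⊗ H) (A ⊗ H)).inv ≫ tensorAct p q ▷ (A ⊗ H) ≫ tensorAct p q := by
  have act_comp_act : (α_ E (A ⊗ H) (A ⊗ H)).inv ≫ tensorAct p q ▷ (A ⊗ H) ≫ tensorAct p q =
      E ◁ (α_ A H (A ⊗ H)).hom ≫ (α_ E A (H ⊗ (A ⊗ H))).inv ≫ p ▷ (H ⊗ (A ⊗ H)) ≫
        E ◁ (α_ H A H).inv ≫ (α_ E (H ⊗ A) H).inv ≫ (α_ E H A).inv ▷ H ≫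
          (q ▷ A ≫ p) ▷ H ≫ q := by
    rw [tensorAct]; monoidal
  have right_right : (α_ E H H).inv ≫ q ▷ H ≫ q = E ◁ μ[H] ≫ q := h.right_mul.symm
  have left_left : (α_ E A A).inv ≫ p ▷ A ≫ p = E ◁ μ[A] ≫ p := h.left_mul.symm
  symm
  calc
    _ = E ◁ (α_ A H (A ⊗ H)).hom ≫ (α_ E A (H ⊗ (A ⊗ H))).inv ≫
        (p ▷ (H ⊗ (A ⊗ H)) ≫ E ◁ ((α_ H A H).inv ≫ ψ ▷ H ≫ (α_ A H H).hom)) ≫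
          (α_ E A (H ⊗ H)).inv ≫ p ▷ (H ⊗ H) ≫ (α_ E H H).inv ≫ q ▷ H ≫ q := by
      rw [act_comp_act, h.right_left]; monoidal
    _ = E ◁ (α_ A H (A ⊗ H)).hom ≫ (α_ E A (H ⊗ (A ⊗ H))).inv ≫
        (E ⊗ A) ◁ ((α_ H A H).inv ≫ ψ ▷ H ≫ (α_ A H H).hom) ≫
          (α_ (E ⊗ A) A (H ⊗ H)).inv ≫ (α_ E A A).hom ▷ (H ⊗ H) ≫
            ((α_ E A A).inv ≫ p ▷ A ≫ p) ▷ (H ⊗ H) ≫ E ◁ μ[H] ≫ q := by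
      rw [← whisker_exchange, right_right]; monoidal
    _ = E ◁ (α_ A H (A ⊗ H)).hom ≫ (α_ E A (H ⊗ (A ⊗ H))).inv ≫
        (E ⊗ A) ◁ ((α_ H A H).inv ≫ ψ ▷ H ≫ (α_ A H H).hom) ≫
          (α_ (E ⊗ A) A (H ⊗ H)).inv ≫ (α_ E A A).hom ▷ (H ⊗ H) ≫
            (E ◁ μ[A]) ▷ (H ⊗ H) ≫ (p ▷ (H ⊗ H) ≫ E ◁ μ[H]) ≫ q := by
      rw [left_left]; monoidal
    _ = _ := by
      rw [← whisker_exchange, twistMul, tensorAct, MonoidalCategory.tensorHom_def]; monoidal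

end IsTwistModule

lemma isTwistModule_of_isMonHom {E : C} [MonObj E] (f : A ⟶ E) (g : H ⟶ E) [IsMonHom f]
    [IsMonHom g] (h : ψ ≫ f ⋆ g = g ⋆ f) : IsTwistModule ψ (𝟙 E ⋆ f) (𝟙 E ⋆ g) where
  left_one := by rw [whiskerLeft_tensorMul, IsMonHom.one_hom, tensorMul_one, Category.comp_id]
  left_mul := by
    rw [whiskerLeft_tensorMul, mul_comp_eq_tensorMul, whiskerRight_tensorMul, Category.comp_id,
      tensorMul_assoc, Iso.inv_hom_id_assoc]
  right_one := by rw [whiskerLeft_tensorMul, IsMonHom.one_hom, tensorMul_one, Category.comp_id]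
  right_mul := by
    rw [whiskerLeft_tensorMul, mul_comp_eq_tensorMul, whiskerRight_tensorMul, Category.comp_id,
      tensorMul_assoc, Iso.inv_hom_id_assoc]
  right_left := by
    rw [whiskerRight_tensorMul, whiskerRight_tensorMul, Category.comp_id, Category.comp_id,
      tensorMul_assoc, tensorMul_assoc, Iso.inv_hom_id_assoc, whiskerLeft_tensorMul, h]

variable (ψ) [IsDistributiveLaw ψ]

lemma twistAct_one : (A ⊗ H) ◁ η[A] ≫ twistAct ψ = (ρ_ (A ⊗ H)).hom := by
  calc
    _ = (α_ A H (𝟙_ C)).hom ≫ A ◁ (H ◁ η[A] ≫ ψ) ≫ (α_ A A H).inv ≫ μ[A] ▷ H := by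
      rw [twistAct]; monoidal
    _ = (ρ_ (A ⊗ H)).hom ≫ (ρ_ A).inv ▷ H ≫ (A ◁ η[A] ≫ μ[A]) ▷ H := by
      rw [IsDistributiveLaw.one_right, tensorInr]; monoidal
    _ = (ρ_ (A ⊗ H)).hom := by
      rw [MonObj.mul_one, inv_hom_whiskerRight, Category.comp_id]

lemma twistAct_mul : (A ⊗ H) ◁ μ[A] ≫ twistAct ψ =
    (α_ (A ⊗ H) A A).inv ≫ twistAct ψ ▷ A ≫ twistAct ψ := by
  calc
    _ = (α_ A H (A ⊗ A)).hom ≫ A ◁ (H ◁ μ[A] ≫ ψ) ≫ (α_ A A H).inv ≫ μ[A] ▷ H := by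
      rw [twistAct]; monoidal
    _ = (α_ A H (A ⊗ A)).hom ≫
        A ◁ ((α_ H A A).inv ≫ ψ ▷ A ≫ (α_ A H A).hom ≫ A ◁ ψ ≫ (α_ A A H).inv) ≫
          (α_ A (A ⊗ A) H).inv ≫ ((α_ A A A).inv ≫ (α_ A A A).hom ≫ A ◁ μ[A] ≫ μ[A]) ▷ H := by
      rw [IsDistributiveLaw.mul_right]; monoidal
    _ = (α_ (A ⊗ H) A A).inv ≫ ((α_ A H A).hom ≫ A ◁ ψ ≫ (α_ A A H).inv) ▷ A ≫
        (α_ (A ⊗ A) H A).hom ≫ ((A ⊗ A) ◁ ψ ≫ μ[A] ▷ (A ⊗ H)) ≫ (α_ A A H).inv ≫ μ[A] ▷ H := by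
      rw [← MonObj.mul_assoc]; monoidal
    _ = _ := by
      rw [whisker_exchange, twistAct]; monoidal

lemma whiskerLeft_mul_twistAct : ((α_ A H H).hom ≫ A ◁ μ[H]) ▷ A ≫ twistAct ψ =
    (α_ (A ⊗ H) H A).hom ≫ (A ⊗ H) ◁ ψ ≫ (α_ (A ⊗ H) A H).inv ≫ twistAct ψ ▷ H ≫
      (α_ A H H).hom ≫ A ◁ μ[H] := by
  calc
    _ = (α_ A H H).hom ▷ A ≫ (α_ A (H ⊗ H) A).hom ≫ A ◁ (μ[H] ▷ A ≫ ψ) ≫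
        (α_ A A H).inv ≫ μ[A] ▷ H := by
      rw [twistAct]; monoidal
    _ = (α_ A H H).hom ▷ A ≫ (α_ A (H ⊗ H) A).hom ≫
        A ◁ ((α_ H H A).hom ≫ H ◁ ψ ≫ (α_ H A H).inv ≫ ψ ▷ H ≫ (α_ A H H).hom) ≫
          (α_ A A (H ⊗ H)).inv ≫ (A ⊗ A) ◁ μ[H] ≫ μ[A] ▷ H := by
      rw [IsDistributiveLaw.mul_left]; monoidal
    _ = _ := by
      rw [whisker_exchange, twistAct]; monoidal

lemma isTwistModule_twistAct : IsTwistModule ψ (twistAct ψ) ((α_ A H H).hom ≫ A ◁ μ[H]) where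
  left_one := twistAct_one ψ
  left_mul := twistAct_mul ψ
  right_one := by
    rw [associator_naturality_right_assoc, ← MonoidalCategory.whiskerLeft_comp, MonObj.mul_one]
    monoidal
  right_mul := by
    calc
      _ = (α_ A H (H ⊗ H)).hom ≫ A ◁ ((α_ H H H).inv ≫ (α_ H H H).hom ≫ H ◁ μ[H] ≫ μ[H]) := by
        monoidal
      _ = _ := by
        rw [← MonObj.mul_assoc]; monoidal
  right_left := whiskerLeft_mul_twistAct ψ

lemma tensorInl_twistMul : tensorInl A H ▷ (A ⊗ H) ≫ twistMul ψ = (α_ A A H).inv ≫ μ[A] ▷ H := by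
  calc
    _ = (ρ_ A).inv ▷ (A ⊗ H) ≫ (α_ A (𝟙_ C) (A ⊗ H)).hom ≫
        A ◁ ((α_ (𝟙_ C) A H).inv ≫ (η[H] ▷ A ≫ ψ) ▷ H ≫ (α_ A H H).hom) ≫
          (α_ A A (H ⊗ H)).inv ≫ (μ[A] ⊗ₘ μ[H]) := by
      rw [twistMul, tensorInl]; monoidal
    _ = (α_ A A H).inv ≫ (A ⊗ A) ◁ ((λ_ H).inv ≫ η[H] ▷ H ≫ μ[H]) ≫ μ[A] ▷ H := by
      rw [IsDistributiveLaw.one_left, tensorInl, MonoidalCategory.tensorHom_def']; monoidal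
    _ = _ := by
      rw [MonObj.one_mul, Iso.inv_hom_id, MonoidalCategory.whiskerLeft_id, Category.id_comp]

lemma twistMul_tensorInl : (A ⊗ H) ◁ tensorInl A H ≫ twistMul ψ = twistAct ψ := by
  rw [twistMul_eq_tensorAct, (isTwistModule_twistAct ψ).tensorInl_act]

lemma twistMul_tensorInr :
    (A ⊗ H) ◁ tensorInr A H ≫ twistMul ψ = (α_ A H H).hom ≫ A ◁ μ[H] := by
  rw [twistMul_eq_tensorAct, (isTwistModule_twistAct ψ).tensorInr_act]

instance : MonObj (twistTensor ψ) where
  one := η[A] ≫ tensorInl A H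
  mul := twistMul ψ
  one_mul := by
    change (η[A] ≫ tensorInl A H) ▷ (A ⊗ H) ≫ twistMul ψ = (λ_ (A ⊗ H)).hom
    rw [comp_whiskerRight_assoc, tensorInl_twistMul, associator_inv_naturality_left_assoc,
      ← comp_whiskerRight, MonObj.one_mul]
    monoidal
  mul_one := by
    change (A ⊗ H) ◁ (η[A] ≫ tensorInl A H) ≫ twistMul ψ = (ρ_ (A ⊗ H)).hom
    rw [twistMul_eq_tensorAct, (isTwistModule_twistAct ψ).one_act]
  mul_assoc := by
    have key := (isTwistModule_twistAct ψ).mul_act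
    rw [← twistMul_eq_tensorAct, Iso.eq_inv_comp] at key
    exact key.symm

instance : IsMonHom (twistInl ψ) where
  one_hom := rfl
  mul_hom := by
    change μ[A] ≫ tensorInl A H = (tensorInl A H ⊗ₘ tensorInl A H) ≫ twistMul ψ
    rw [MonoidalCategory.tensorHom_def', Category.assoc, tensorInl_twistMul, tensorInl,
      rightUnitor_inv_naturality_assoc, ← whisker_exchange]
    monoidal

instance : IsMonHom (twistInr ψ) where
  one_hom := (one_comp_tensorInr (A := A) (H := H)).trans one_comp_tensorInl.symm
  mul_hom := by
    change μ[H] ≫ tensorInr A H = (tensorInr A H ⊗ₘ tensorInr A H) ≫ twistMul ψ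
    rw [MonoidalCategory.tensorHom_def, Category.assoc, twistMul_tensorInr, tensorInr,
      leftUnitor_inv_naturality_assoc, whisker_exchange]
    monoidal

lemma twistInl_tensorMul_twistInr : twistInl ψ ⋆ twistInr ψ = 𝟙 (twistTensor ψ) := by
  change (tensorInl A H ⊗ₘ tensorInr A H) ≫ twistMul ψ = 𝟙 (A ⊗ H)
  calc
    _ = (ρ_ A).inv ▷ H ≫ (α_ A (𝟙_ C) H).hom ≫ A ◁ (η[H] ▷ H ≫ μ[H]) := by
      rw [MonoidalCategory.tensorHom_def, Category.assoc, twistMul_tensorInr, tensorInl]; monoidal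
    _ = 𝟙 (A ⊗ H) := by
      rw [MonObj.one_mul]; monoidal

instance : IsIso (twistInl ψ ⋆ twistInr ψ) := by
  rw [twistInl_tensorMul_twistInr]
  exact IsIso.id (A ⊗ H)

lemma twistInr_tensorMul_twistInl : twistInr ψ ⋆ twistInl ψ = ψ := by
  change (tensorInr A H ⊗ₘ tensorInl A H) ≫ twistMul ψ = ψ
  calc
    _ = (λ_ H).inv ▷ A ≫ (α_ (𝟙_ C) H A).hom ≫ (η[A] ▷ (H ⊗ A) ≫ A ◁ ψ) ≫
        (α_ A A H).inv ≫ μ[A] ▷ H := by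
      rw [MonoidalCategory.tensorHom_def, Category.assoc, twistMul_tensorInl, tensorInr, twistAct]
      monoidal
    _ = (λ_ (H ⊗ A)).inv ≫ 𝟙_ C ◁ ψ ≫ (α_ (𝟙_ C) A H).inv ≫ (η[A] ▷ A ≫ μ[A]) ▷ H := by
      rw [← whisker_exchange]; monoidal
    _ = ψ := by
      rw [MonObj.one_mul]; monoidal

lemma isMonHom_tensorMul {E : C} [MonObj E] (f : A ⟶ E) (g : H ⟶ E) [IsMonHom f] [IsMonHom g]
    (h : ψ ≫ f ⋆ g = g ⋆ f) :
    @IsMonHom C _ _ (twistTensor ψ) E _ _ (f ⋆ g) where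
  one_hom := by
    change (η[A] ≫ tensorInl A H) ≫ f ⋆ g = η[E]
    rw [one_comp_tensorInl, Category.assoc, tensorHom_tensorMul, IsMonHom.one_hom,
      IsMonHom.one_hom, one_tensorMul, Iso.inv_hom_id_assoc]
  mul_hom := by
    change twistMul ψ ≫ f ⋆ g = (f ⋆ g) ⋆ (f ⋆ g)
    have act_eq : tensorAct (𝟙 E ⋆ f) (𝟙 E ⋆ g) = 𝟙 E ⋆ (f ⋆ g) := by
      rw [tensorAct, whiskerRight_tensorMul, Category.comp_id, tensorMul_assoc,
        Iso.inv_hom_id_assoc]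
    have key := (isTwistModule_of_isMonHom f g h).mul_act
    rw [act_eq, whiskerLeft_tensorMul, whiskerRight_tensorMul, Category.comp_id, tensorMul_assoc,
      Iso.inv_hom_id_assoc] at key
    rw [← cancel_epi (λ_ _).hom, ← one_tensorMul, ← one_tensorMul, ← Category.comp_id η[E],
      ← whiskerRight_tensorMul, key, whiskerRight_tensorMul]

end TwistedTensor

section LinearExtension

variable {B X Y Z : C} [MonObj B]

/-- The extension of `k : X ⟶ B ⊗ Y` to a morphism of free left `B`-modules. It is the Kleisli
extension for the monad `B ⊗ -`. -/
def linearExtend (k : X ⟶ B ⊗ Y) : B ⊗ X ⟶ B ⊗ Y :=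
  B ◁ k ≫ (α_ B B Y).inv ≫ μ[B] ▷ Y

lemma tensorInr_linearExtend (k : X ⟶ B ⊗ Y) : tensorInr B X ≫ linearExtend k = k := by
  calc
    _ = (λ_ X).inv ≫ (η[B] ▷ X ≫ B ◁ k) ≫ (α_ B B Y).inv ≫ μ[B] ▷ Y := by
      simp only [tensorInr, linearExtend, Category.assoc]
    _ = (λ_ X).inv ≫ 𝟙_ C ◁ k ≫ (α_ (𝟙_ C) B Y).inv ≫ (η[B] ▷ B ≫ μ[B]) ▷ Y := by
      rw [← whisker_exchange]; monoidal
    _ = k := by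
      rw [MonObj.one_mul]; monoidal

lemma linearExtend_tensorInr : linearExtend (tensorInr B X) = 𝟙 (B ⊗ X) := by
  calc
    _ = B ◁ (λ_ X).inv ≫ (α_ B (𝟙_ C) X).inv ≫ (B ◁ η[B] ≫ μ[B]) ▷ X := by
      rw [linearExtend, tensorInr]; monoidal
    _ = 𝟙 (B ⊗ X) := by
      rw [MonObj.mul_one]; monoidal

lemma linearExtend_comp_linearExtend (k : X ⟶ B ⊗ Y) (n : Y ⟶ B ⊗ Z) :
    linearExtend k ≫ linearExtend n = linearExtend (k ≫ linearExtend n) := by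
  calc
    _ = B ◁ k ≫ (α_ B B Y).inv ≫ (μ[B] ▷ Y ≫ B ◁ n) ≫ (α_ B B Z).inv ≫ μ[B] ▷ Z := by
      simp only [linearExtend, Category.assoc]
    _ = B ◁ k ≫ B ◁ B ◁ n ≫ (α_ B B (B ⊗ Z)).inv ≫ (α_ (B ⊗ B) B Z).inv ≫
        (μ[B] ▷ B ≫ μ[B]) ▷ Z := by
      rw [← whisker_exchange]; monoidal
    _ = _ := by
      rw [MonObj.mul_assoc, linearExtend, linearExtend]; monoidal

lemma isIso_linearExtend_iff (k : X ⟶ B ⊗ Y) : IsIso (linearExtend k) ↔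
    ∃ n : Y ⟶ B ⊗ X, k ≫ linearExtend n = tensorInr B X ∧ n ≫ linearExtend k = tensorInr B Y := by
  constructor
  · intro _
    have comp_eq : (tensorInr B Y ≫ inv (linearExtend k)) ≫ linearExtend k = tensorInr B Y := by
      rw [Category.assoc, IsIso.inv_hom_id, Category.comp_id]
    refine ⟨tensorInr B Y ≫ inv (linearExtend k), ?_, comp_eq⟩
    have inv_eq : linearExtend (tensorInr B Y ≫ inv (linearExtend k)) = inv (linearExtend k) :=
      IsIso.eq_inv_of_inv_hom_id
        (by rw [linearExtend_comp_linearExtend, comp_eq, linearExtend_tensorInr])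
    rw [inv_eq, IsIso.comp_inv_eq, tensorInr_linearExtend]
  · rintro ⟨n, hk, hn⟩
    exact ⟨linearExtend n, by rw [linearExtend_comp_linearExtend, hk, linearExtend_tensorInr],
      by rw [linearExtend_comp_linearExtend, hn, linearExtend_tensorInr]⟩

lemma linearExtend_comp_whiskerRight {A : C} [MonObj A] (f : A ⟶ B) [IsMonHom f]
    (k : X ⟶ A ⊗ Y) : linearExtend k ≫ f ▷ Y = f ▷ X ≫ linearExtend (k ≫ f ▷ Y) := by
  calc
    _ = A ◁ k ≫ (α_ A A Y).inv ≫ (μ[A] ≫ f) ▷ Y := by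
      simp only [linearExtend, Category.assoc, comp_whiskerRight]
    _ = A ◁ k ≫ (α_ A A Y).inv ≫ (A ◁ f ≫ f ▷ B ≫ μ[B]) ▷ Y := by
      rw [IsMonHom.mul_hom, MonoidalCategory.tensorHom_def', Category.assoc]
    _ = A ◁ (k ≫ f ▷ Y) ≫ f ▷ (B ⊗ Y) ≫ (α_ B B Y).inv ≫ μ[B] ▷ Y := by
      monoidal
    _ = _ := by
      rw [whisker_exchange_assoc, linearExtend]

lemma isIso_linearExtend_comp_whiskerRight {A : C} [MonObj A] (f : A ⟶ B) [IsMonHom f]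
    (k : X ⟶ A ⊗ Y) [IsIso (linearExtend k)] : IsIso (linearExtend (k ≫ f ▷ Y)) := by
  have tensorInr_comp (Z : C) : tensorInr A Z ≫ f ▷ Z = tensorInr B Z := by
    rw [tensorInr, Category.assoc, ← comp_whiskerRight, IsMonHom.one_hom, tensorInr]
  obtain ⟨n, hk, hn⟩ := (isIso_linearExtend_iff k).1 inferInstance
  refine (isIso_linearExtend_iff _).2 ⟨n ≫ f ▷ X, ?_, ?_⟩
  · rw [Category.assoc, ← linearExtend_comp_whiskerRight, reassoc_of% hk, tensorInr_comp]
  · rw [Category.assoc, ← linearExtend_comp_whiskerRight, reassoc_of% hn, tensorInr_comp]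

lemma linearExtend_tensorMul {A : C} [MonObj A] (i : A ⟶ B) [IsMonHom i] (q : Y ⟶ B)
    (k : X ⟶ A ⊗ Y) : linearExtend k ≫ i ⋆ q = i ⋆ (k ≫ i ⋆ q) := by
  rw [linearExtend, Category.assoc, Category.assoc, whiskerRight_tensorMul,
    mul_comp_eq_tensorMul, tensorMul_assoc, Iso.inv_hom_id_assoc, whiskerLeft_tensorMul]

lemma tensorMul_whiskerRight_linearExtend {A T : C} [MonObj T] (i : A ⟶ B) (j : T ⟶ B) [IsMonHom j]
    (k : X ⟶ T ⊗ Y) : (i ⋆ j) ▷ X ≫ linearExtend (k ≫ j ▷ Y) =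
      (α_ A T X).hom ≫ A ◁ linearExtend k ≫ (α_ A T Y).inv ≫ (i ⋆ j) ▷ Y := by
  calc
    _ = ((i ⋆ j) ▷ X ≫ B ◁ k) ≫ (α_ B T Y).inv ≫ (B ◁ j ≫ μ[B]) ▷ Y := by
      rw [linearExtend]; monoidal
    _ = (A ⊗ T) ◁ k ≫ (α_ (A ⊗ T) T Y).inv ≫ ((i ⋆ j) ▷ T ≫ 𝟙 B ⋆ j) ▷ Y := by
      rw [← whisker_exchange, tensorMul_eq_whiskerLeft_comp (𝟙 B)]; monoidal
    _ = (A ⊗ T) ◁ k ≫ (α_ (A ⊗ T) T Y).inv ≫ ((α_ A T T).hom ≫ A ◁ μ[T] ≫ i ⋆ j) ▷ Y := by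
      rw [whiskerRight_tensorMul, Category.comp_id, tensorMul_assoc, whiskerLeft_tensorMul,
        mul_comp_eq_tensorMul]
    _ = _ := by
      rw [linearExtend]; monoidal

end LinearExtension

section BraidedTensor

variable [BraidedCategory C]

instance (B H : C) [MonObj B] [MonObj H] : IsDistributiveLaw (β_ H B).hom where
  one_left := by
    rw [BraidedCategory.braiding_naturality_left, braiding_tensorUnit_left, tensorInl,
      Category.assoc]
  one_right := by
    rw [BraidedCategory.braiding_naturality_right, braiding_tensorUnit_right, tensorInr,
      Category.assoc]
  mul_left := by
    rw [BraidedCategory.braiding_naturality_left, BraidedCategory.braiding_tensor_left_hom]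
    simp only [Category.assoc]
  mul_right := by
    rw [BraidedCategory.braiding_naturality_right, BraidedCategory.braiding_tensor_right_hom]
    simp only [Category.assoc]

lemma twistMul_braiding (B H : C) [MonObj B] [MonObj H] :
    twistMul (β_ H B).hom = μ[B ⊗ H] := by
  change _ = tensorμ B H B H ≫ (μ[B] ⊗ₘ μ[H])
  simp [twistMul, tensorμ]

instance (B H : C) [MonObj B] [MonObj H] : IsMonHom (tensorInl B H) where
  one_hom := one_comp_tensorInl
  mul_hom := by
    rw [← twistMul_braiding]
    exact IsMonHom.mul_hom (twistInl (β_ H B).hom)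

instance (H : C) [BimonObj H] : IsMonHom Δ[H] where
  one_hom := BimonObj.one_comul H
  mul_hom := BimonObj.mul_comul H

lemma tensorInl_tensorMul_id (B H : C) [MonObj B] [MonObj H] :
    tensorInl B H ⋆ 𝟙 (B ⊗ H) = (α_ B B H).inv ≫ μ[B] ▷ H := by
  rw [tensorMul, tensorHom_id, ← twistMul_braiding, tensorInl_twistMul]

lemma id_tensorMul_tensorInl (B H : C) [MonObj B] [MonObj H] :
    𝟙 (B ⊗ H) ⋆ tensorInl B H =
      (α_ B H B).hom ≫ B ◁ (β_ H B).hom ≫ (α_ B B H).inv ≫ μ[B] ▷ H := by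
  rw [tensorMul, id_tensorHom, ← twistMul_braiding, twistMul_tensorInl, twistAct]

variable {A B H : C} [MonObj B] [MonObj H]

lemma comp_tensorInl_tensorMul {X Y : C} (p : A ⟶ B) (q : X ⟶ B) (k : Y ⟶ X ⊗ H) :
    (p ≫ tensorInl B H) ⋆ (k ≫ q ▷ H) = A ◁ k ≫ (α_ A X H).inv ≫ (p ⋆ q) ▷ H := by
  calc
    _ = A ◁ k ≫ A ◁ q ▷ H ≫ p ▷ (B ⊗ H) ≫ tensorInl B H ⋆ 𝟙 (B ⊗ H) := by
      simp only [whiskerLeft_tensorMul, whiskerRight_tensorMul, Category.comp_id]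
    _ = _ := by
      rw [tensorInl_tensorMul_id, tensorMul_eq_whiskerRight_comp]; monoidal

lemma tensorMul_comp_tensorInl {X Y : C} (p : A ⟶ B) (q : X ⟶ B) (k : Y ⟶ X ⊗ H) :
    (k ≫ q ▷ H) ⋆ (p ≫ tensorInl B H) =
      k ▷ A ≫ (α_ X H A).hom ≫ X ◁ (β_ H A).hom ≫ (α_ X A H).inv ≫ (q ⋆ p) ▷ H := by
  calc
    _ = k ▷ A ≫ q ▷ H ▷ A ≫ (B ⊗ H) ◁ p ≫ 𝟙 (B ⊗ H) ⋆ tensorInl B H := by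
      simp only [whiskerLeft_tensorMul, whiskerRight_tensorMul, Category.comp_id]
    _ = k ▷ A ≫ q ▷ H ▷ A ≫ (α_ B H A).hom ≫ B ◁ (H ◁ p ≫ (β_ H B).hom) ≫ (α_ B B H).inv ≫
        μ[B] ▷ H := by
      rw [id_tensorMul_tensorInl]; monoidal
    _ = k ▷ A ≫ (α_ X H A).hom ≫ (q ▷ (H ⊗ A) ≫ B ◁ (β_ H A).hom) ≫ (α_ B A H).inv ≫
        (B ◁ p ≫ μ[B]) ▷ H := by
      rw [BraidedCategory.braiding_naturality_right]; monoidal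
    _ = _ := by
      rw [← whisker_exchange, tensorMul_eq_whiskerLeft_comp]; monoidal

end BraidedTensor

section Hopf

variable [BraidedCategory C] {A B H T : C} [MonObj B] [HopfObj H]

instance : IsIso (linearExtend Δ[H]) := by
  refine (isIso_linearExtend_iff _).2 ⟨Δ[H] ≫ HopfObj.antipode ▷ H, ?_, ?_⟩
  · calc
      _ = (Δ[H] ≫ H ◁ Δ[H]) ≫ (α_ H H H).inv ≫ (H ◁ HopfObj.antipode ≫ μ[H]) ▷ H := by
        rw [linearExtend]; monoidal
      _ = Δ[H] ≫ (Δ[H] ≫ H ◁ HopfObj.antipode ≫ μ[H]) ▷ H := by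
        rw [ComonObj.comul_assoc]; monoidal
      _ = tensorInr H H := by
        rw [HopfObj.antipode_right, comp_whiskerRight, ComonObj.counit_comul_assoc, tensorInr]
  · calc
      _ = Δ[H] ≫ (HopfObj.antipode ▷ H ≫ H ◁ Δ[H]) ≫ (α_ H H H).inv ≫ μ[H] ▷ H := by
        simp only [linearExtend, Category.assoc]
      _ = (Δ[H] ≫ H ◁ Δ[H]) ≫ (α_ H H H).inv ≫ (HopfObj.antipode ▷ H ≫ μ[H]) ▷ H := by
        rw [← whisker_exchange]; monoidal
      _ = Δ[H] ≫ (Δ[H] ≫ HopfObj.antipode ▷ H ≫ μ[H]) ▷ H := by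
        rw [ComonObj.comul_assoc]; monoidal
      _ = tensorInr H H := by
        rw [HopfObj.antipode_left, comp_whiskerRight, ComonObj.counit_comul_assoc, tensorInr]

variable (i : A ⟶ B) (q : H ⟶ B) (j : T ⟶ B)

lemma tensorMul_comp_coact {ρ : B ⟶ B ⊗ H} [IsMonHom ρ] (hi : i ≫ ρ = i ≫ tensorInl B H)
    (hq : q ≫ ρ = Δ[H] ≫ q ▷ H) :
    (i ⋆ q) ≫ ρ = A ◁ Δ[H] ≫ (α_ A H H).inv ≫ (i ⋆ q) ▷ H := by
  rw [tensorMul_comp, hi, hq, comp_tensorInl_tensorMul]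

variable [MonObj A] [IsMonHom i] [IsMonHom q] [IsIso (i ⋆ q)] [IsIso (i ⋆ j)]

lemma isIso_linearExtend_comp_coact {ρ : B ⟶ B ⊗ H} [IsMonHom ρ]
    (hi : i ≫ ρ = i ≫ tensorInl B H) (hq : q ≫ ρ = Δ[H] ≫ q ▷ H) :
    IsIso (linearExtend (j ≫ ρ)) := by
  obtain ⟨k, hk⟩ : ∃ k : T ⟶ A ⊗ H, k ≫ i ⋆ q = j := ⟨j ≫ inv (i ⋆ q), by simp⟩
  have : IsIso (linearExtend k) := by
    have : IsIso (linearExtend k ≫ i ⋆ q) := by rwa [linearExtend_tensorMul, hk]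
    exact IsIso.of_isIso_comp_right _ (i ⋆ q)
  have factorization : j ≫ ρ = (k ≫ i ▷ H) ≫ linearExtend (Δ[H] ≫ q ▷ H) := by
    calc
      j ≫ ρ = k ≫ A ◁ Δ[H] ≫ (α_ A H H).inv ≫ (i ▷ H ≫ B ◁ q ≫ μ[B]) ▷ H := by
        rw [← hk, Category.assoc, tensorMul_comp_coact i q hi hq, tensorMul_eq_whiskerLeft_comp]
      _ = k ≫ (A ◁ Δ[H] ≫ i ▷ (H ⊗ H)) ≫ B ◁ q ▷ H ≫ (α_ B B H).inv ≫ μ[B] ▷ H := by monoidal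
      _ = _ := by
        rw [whisker_exchange, linearExtend, MonoidalCategory.whiskerLeft_comp]
        simp only [Category.assoc]
  have := isIso_linearExtend_comp_whiskerRight i k
  have := isIso_linearExtend_comp_whiskerRight q Δ[H]
  rw [factorization, ← linearExtend_comp_linearExtend]
  infer_instance

lemma isIso_whiskerLeft_can [MonObj T] [IsMonHom j] {ρ : B ⟶ B ⊗ H} [IsMonHom ρ]
    (hi : i ≫ ρ = i ≫ tensorInl B H) (hq : q ≫ ρ = Δ[H] ≫ q ▷ H) {ρT : T ⟶ T ⊗ H}
    (hρT : ρT ≫ j ▷ H = j ≫ ρ) : IsIso (A ◁ can H T ρT) := by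
  have := isIso_linearExtend_comp_coact i q j hi hq
  have can_eq : A ◁ can H T ρT =
      (α_ A T T).inv ≫ (i ⋆ j) ▷ T ≫ linearExtend (j ≫ ρ) ≫ inv ((i ⋆ j) ▷ H) ≫
        (α_ A T H).hom := by
    rw [← hρT, reassoc_of% tensorMul_whiskerRight_linearExtend i j ρT]
    simp [linearExtend, can]
  rw [can_eq]
  infer_instance

end Hopf

section BaseChange

section Dual

variable {A D H M N X : C} [ExactPairing D A] (l r : A ⊗ M ⟶ N)

lemma comp_tensorLeftHomEquiv_eq_iff (f : X ⟶ M) :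
    f ≫ tensorLeftHomEquiv M D A N l = f ≫ tensorLeftHomEquiv M D A N r ↔
      A ◁ f ≫ l = A ◁ f ≫ r := by
  rw [← (tensorLeftHomEquiv X D A N).symm.injective.eq_iff, tensorLeftHomEquiv_symm_naturality,
    tensorLeftHomEquiv_symm_naturality, Equiv.symm_apply_apply, Equiv.symm_apply_apply]

lemma comp_tensorLeftHomEquiv_whiskerRight_eq_iff (f : X ⟶ M ⊗ H) :
    f ≫ tensorLeftHomEquiv M D A N l ▷ H = f ≫ tensorLeftHomEquiv M D A N r ▷ H ↔
      A ◁ f ≫ (α_ A M H).inv ≫ l ▷ H = A ◁ f ≫ (α_ A M H).inv ≫ r ▷ H := by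
  have transpose_eq (k : A ⊗ M ⟶ N) :
      (tensorLeftHomEquiv X D A (N ⊗ H)).symm
        ((f ≫ tensorLeftHomEquiv M D A N k ▷ H) ≫ (α_ D N H).hom) =
      A ◁ f ≫ (α_ A M H).inv ≫ k ▷ H := by
    rw [Category.assoc, tensorLeftHomEquiv_symm_naturality, ← tensorHom_id,
      tensorLeftHomEquiv_tensor, Equiv.symm_apply_apply, tensorHom_id]
  rw [← cancel_mono (α_ D N H).hom, ← (tensorLeftHomEquiv X D A (N ⊗ H)).symm.injective.eq_iff,
    transpose_eq, transpose_eq]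

end Dual

lemma Flat.tensor {X Y : C} (hX : Flat X) (hY : Flat Y) : Flat (X ⊗ Y) :=
  have : PreservesLimitsOfShape WalkingParallelPair (tensorLeft X) := hX
  have : PreservesLimitsOfShape WalkingParallelPair (tensorLeft Y) := hY
  preservesLimitsOfShape_of_natIso (tensorLeftTensor X Y).symm

variable [BraidedCategory C]

lemma Flat.preservesLimitsOfShape_tensorRight {H : C} (hH : Flat H) :
    PreservesLimitsOfShape WalkingParallelPair (tensorRight H) :=
  have : PreservesLimitsOfShape WalkingParallelPair (tensorLeft H) := hH
  preservesLimitsOfShape_of_natIso (BraidedCategory.tensorLeftIsoTensorRight H)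

variable {A B H T : C} [MonObj B] {i : A ⟶ B} {j : T ⟶ B}

lemma centralizes_comp_tensorInl_iff [MonObj H] (hβ : (β_ A H).hom ≫ (β_ H A).hom = 𝟙 (A ⊗ H))
    {X : C} (f : X ⟶ B ⊗ H) : Centralizes (i ≫ tensorInl B H) f ↔
      A ◁ f ≫ (α_ A B H).inv ≫ (i ⋆ 𝟙 B) ▷ H =
        A ◁ f ≫ (α_ A B H).inv ≫ ((β_ A B).hom ≫ 𝟙 B ⋆ i) ▷ H := by
  have left_eq : (i ≫ tensorInl B H) ⋆ 𝟙 (B ⊗ H) = (α_ A B H).inv ≫ (i ⋆ 𝟙 B) ▷ H := by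
    simpa using comp_tensorInl_tensorMul i (𝟙 B) (𝟙 (B ⊗ H))
  have right_eq : (β_ A (B ⊗ H)).hom ≫ 𝟙 (B ⊗ H) ⋆ (i ≫ tensorInl B H) =
      (α_ A B H).inv ≫ ((β_ A B).hom ≫ 𝟙 B ⋆ i) ▷ H := by
    have mul_eq : 𝟙 (B ⊗ H) ⋆ (i ≫ tensorInl B H) =
        (α_ B H A).hom ≫ B ◁ (β_ H A).hom ≫ (α_ B A H).inv ≫ (𝟙 B ⋆ i) ▷ H := by
      simpa using tensorMul_comp_tensorInl i (𝟙 B) (𝟙 (B ⊗ H))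
    rw [mul_eq, BraidedCategory.braiding_tensor_right_hom]
    simp only [Category.assoc, Iso.inv_hom_id_assoc]
    rw [← MonoidalCategory.whiskerLeft_comp_assoc B, hβ]
    monoidal
  rw [centralizes_iff_whiskerLeft_comp, left_eq, right_eq]

namespace IsCentralizer

lemma comp_tensorLeftHomEquiv (h : IsCentralizer i j) (D : C) [ExactPairing D A] :
    j ≫ tensorLeftHomEquiv B D A B (i ⋆ 𝟙 B) =
      j ≫ tensorLeftHomEquiv B D A B ((β_ A B).hom ≫ 𝟙 B ⋆ i) :=
  (comp_tensorLeftHomEquiv_eq_iff _ _ j).2 ((centralizes_iff_whiskerLeft_comp j).1 h.centralizes)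

lemma whiskerRight_comp_tensorLeftHomEquiv (h : IsCentralizer i j) (D H : C)
    [ExactPairing D A] :
    j ▷ H ≫ tensorLeftHomEquiv B D A B (i ⋆ 𝟙 B) ▷ H =
      j ▷ H ≫ tensorLeftHomEquiv B D A B ((β_ A B).hom ≫ 𝟙 B ⋆ i) ▷ H := by
  rw [← comp_whiskerRight, h.comp_tensorLeftHomEquiv, comp_whiskerRight]

/-- The embedding of a centralizer is an equalizer of two morphisms `B ⟶ D ⊗ B`. As opposed to
morphisms to the internal hom, these are compatible with tensor products from the right. -/
def isLimit (h : IsCentralizer i j) (D : C) [ExactPairing D A] :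
    IsLimit (Fork.ofι j (h.comp_tensorLeftHomEquiv D)) :=
  have exists_lift (s : Fork (tensorLeftHomEquiv B D A B (i ⋆ 𝟙 B))
      (tensorLeftHomEquiv B D A B ((β_ A B).hom ≫ 𝟙 B ⋆ i))) : ∃ g : s.pt ⟶ T, g ≫ j = s.ι :=
    h.exists_lift s.ι ((centralizes_iff_whiskerLeft_comp _).2
      ((comp_tensorLeftHomEquiv_eq_iff _ _ _).1 s.condition))
  have := h.mono
  Fork.IsLimit.mk _ (fun s => (exists_lift s).choose) (fun s => (exists_lift s).choose_spec)
    fun s _ hm => (cancel_mono j).1 (hm.trans (exists_lift s).choose_spec.symm)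

/-- The base change of `IsCentralizer.isLimit` to a flat object. -/
def isLimitWhiskerRight (h : IsCentralizer i j) (D : C) [ExactPairing D A] (hH : Flat H) :
    IsLimit (Fork.ofι (j ▷ H) (h.whiskerRight_comp_tensorLeftHomEquiv D H)) :=
  have := hH.preservesLimitsOfShape_tensorRight
  isLimitForkMapOfIsLimit (tensorRight H) (h.comp_tensorLeftHomEquiv D) (h.isLimit D)

lemma mono_whiskerRight (h : IsCentralizer i j) (D : C) [ExactPairing D A] (hH : Flat H) :
    Mono (j ▷ H) :=
  Fork.IsLimit.mono (h.isLimitWhiskerRight D hH)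

lemma comp_tensorInl [MonObj H] (h : IsCentralizer i j) (D : C) [ExactPairing D A]
    (hH : Flat H) (hβ : (β_ A H).hom ≫ (β_ H A).hom = 𝟙 (A ⊗ H)) :
    IsCentralizer (i ≫ tensorInl B H) (j ▷ H) := by
  have centralizes_iff {X : C} (f : X ⟶ B ⊗ H) :=
    (centralizes_comp_tensorInl_iff (i := i) hβ f).trans
      (comp_tensorLeftHomEquiv_whiskerRight_eq_iff (D := D) _ _ f).symm
  exact
    { mono := h.mono_whiskerRight D hH
      centralizes := (centralizes_iff _).2 (h.whiskerRight_comp_tensorLeftHomEquiv D H)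
      exists_lift f hf :=
        ⟨_, (Fork.IsLimit.lift' (h.isLimitWhiskerRight D hH) f ((centralizes_iff f).1 hf)).2⟩ }

end IsCentralizer

end BaseChange

section FaithfulFlatness

section

variable {A T X Y : C}

lemma FaithfullyFlat.of_iso (hX : FaithfullyFlat X) (e : X ≅ Y) : FaithfullyFlat Y :=
  have : PreservesLimitsOfShape WalkingParallelPair (tensorLeft X) := hX.1
  have := hX.2
  have e' : tensorLeft X ≅ tensorLeft Y := (curriedTensor C).mapIso e
  ⟨preservesLimitsOfShape_of_natIso e', reflectsLimitsOfShape_of_natIso e'⟩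

lemma FaithfullyFlat.tensor (hX : FaithfullyFlat X) (hY : FaithfullyFlat Y) :
    FaithfullyFlat (X ⊗ Y) :=
  have := hX.2
  have := hY.2
  ⟨hX.1.tensor hY.1, reflectsLimitsOfShape_of_natIso (tensorLeftTensor X Y).symm⟩

lemma FaithfullyFlat.of_tensor (hA : FaithfullyFlat A) (hAT : FaithfullyFlat (A ⊗ T)) :
    FaithfullyFlat T :=
  have := hA.2
  have := hAT.2
  have : PreservesLimitsOfShape WalkingParallelPair (tensorLeft A) := hA.1
  have : PreservesLimitsOfShape WalkingParallelPair (tensorLeft (A ⊗ T)) := hAT.1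
  have : PreservesLimitsOfShape WalkingParallelPair (tensorLeft T ⋙ tensorLeft A) :=
    preservesLimitsOfShape_of_natIso (tensorLeftTensor A T)
  have : ReflectsLimitsOfShape WalkingParallelPair (tensorLeft T ⋙ tensorLeft A) :=
    reflectsLimitsOfShape_of_natIso (tensorLeftTensor A T)
  ⟨preservesLimitsOfShape_of_reflects_of_preserves (tensorLeft T) (tensorLeft A),
    ⟨fun {_} => ⟨fun hc => ⟨isLimitOfReflects (tensorLeft T ⋙ tensorLeft A)
      (isLimitOfPreserves (tensorLeft A) hc)⟩⟩⟩⟩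

lemma Flat.faithfullyFlat [HasEqualizers C] (hX : Flat X) [(tensorLeft X).ReflectsIsomorphisms] :
    FaithfullyFlat X :=
  have : PreservesLimitsOfShape WalkingParallelPair (tensorLeft X) := hX
  ⟨hX, reflectsLimitsOfShape_of_reflectsIsomorphisms⟩

lemma isIso_tensorUnit_whiskerLeft_iff (f : X ⟶ Y) : IsIso (𝟙_ C ◁ f) ↔ IsIso f :=
  NatIso.isIso_map_iff (leftUnitorNatIso C) f

lemma reflectsIsomorphisms_tensorLeft_of_retract (h : Retract (𝟙_ C) A) :
    (tensorLeft A).ReflectsIsomorphisms where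
  reflects f hf := (isIso_tensorUnit_whiskerLeft_iff f).1 <|
    (MorphismProperty.isomorphisms C).of_retract
      (NatTrans.retractArrowApp ((curriedTensor C).flip.map f) h) hf

end

variable [BraidedCategory C]

lemma Flat.faithfullyFlat_of_bimonObj [HasEqualizers C] {H : C} [BimonObj H] (hH : Flat H) :
    FaithfullyFlat H :=
  have := reflectsIsomorphisms_tensorLeft_of_retract
    { i := η[H], r := ε[H], retract := BimonObj.one_counit H }
  hH.faithfullyFlat

lemma isIso_tensor_whiskerLeft (P Q : C) {X Y : C} (f : X ⟶ Y) [IsIso (P ◁ f)] :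
    IsIso ((P ⊗ Q) ◁ f) :=
  (NatIso.isIso_map_iff ((curriedTensor C).mapIso (β_ P Q) ≪≫ tensorLeftTensor Q P) f).2
    (inferInstanceAs (IsIso (Q ◁ P ◁ f)))

variable [MonoidalClosed C] {P : C}

lemma IsFinite.flat (hP : IsFinite P) : Flat P :=
  let := hP.exactPairingSwap
  (tensorLeftAdjunction P (dual P)).rightAdjoint_preservesLimits.preservesLimitsOfShape

/-- As `P ⊗ [P, P] ⊗ P* ⇉ P ⊗ P* ⟶ I` remains a coequalizer after tensoring with an object, the
inverse of `P ⊗ P* ⊗ f` descends to an inverse of `I ⊗ f`. -/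
lemma IsFaithfullyProjective.reflectsIsomorphisms_tensorLeft (hP : IsFaithfullyProjective P) :
    (tensorLeft P).ReflectsIsomorphisms where
  reflects {X Y} f hf := by
    obtain ⟨isColimit⟩ := hP.coequalizer
    have isColimit_whiskerRight (Z : C) :=
      isColimitCoforkMapOfIsColimit (tensorRight Z) (evDual_condition P) isColimit
    have (Z : C) : Epi (evDual P ▷ Z) := Cofork.IsColimit.epi (isColimit_whiskerRight Z)
    have : IsIso (P ◁ f) := hf
    have := isIso_tensor_whiskerLeft P (dual P) f
    have := isIso_tensor_whiskerLeft P ((ihom P).obj P) f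
    have := isIso_tensor_whiskerLeft (P ⊗ (ihom P).obj P) (dual P) f
    obtain ⟨g, hg⟩ : ∃ g : 𝟙_ C ⊗ Y ⟶ 𝟙_ C ⊗ X,
        evDual P ▷ Y ≫ g = inv ((P ⊗ dual P) ◁ f) ≫ evDual P ▷ X := by
      refine ⟨_, (Cofork.IsColimit.desc' (isColimit_whiskerRight Y) _ ?_).2⟩
      change (evEnd P ▷ dual P) ▷ Y ≫ _ =
        ((α_ P ((ihom P).obj P) (dual P)).hom ≫ P ◁ endActDual P) ▷ Y ≫ _
      rw [← cancel_epi (((P ⊗ (ihom P).obj P) ⊗ dual P) ◁ f), whisker_exchange_assoc,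
        whisker_exchange_assoc, IsIso.hom_inv_id_assoc, ← comp_whiskerRight,
        ← comp_whiskerRight, evDual_condition]
    refine (isIso_tensorUnit_whiskerLeft_iff f).1 ⟨g, ?_, ?_⟩
    · rw [← cancel_epi (evDual P ▷ X), ← whisker_exchange_assoc, hg, IsIso.hom_inv_id_assoc,
        Category.comp_id]
    · rw [← cancel_epi (evDual P ▷ Y), reassoc_of% hg, ← whisker_exchange,
        IsIso.inv_hom_id_assoc, Category.comp_id]

end FaithfulFlatness

section Galois

lemma IsRightComodule.of_mono {H B T : C} [ComonObj H] {ρ : B ⟶ B ⊗ H} (hρ : IsRightComodule H ρ)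
    (j : T ⟶ B) [Mono j] [Mono (j ▷ (H ⊗ H))] {ρT : T ⟶ T ⊗ H} (hρT : ρT ≫ j ▷ H = j ≫ ρ) :
    IsRightComodule H ρT where
  counit := by
    rw [← cancel_mono (ρ_ T).hom, ← cancel_mono j, Iso.inv_hom_id, Category.id_comp,
      Category.assoc, Category.assoc, ← rightUnitor_naturality, whisker_exchange_assoc,
      reassoc_of% hρT, reassoc_of% hρ.counit, Iso.inv_hom_id, Category.comp_id]
  coassoc := by
    rw [← cancel_mono (j ▷ (H ⊗ H))]
    simp only [Category.assoc]
    rw [whisker_exchange, reassoc_of% hρT, hρ.coassoc, ← associator_naturality_left,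
      ← comp_whiskerRight_assoc, hρT, comp_whiskerRight_assoc, reassoc_of% hρT]

variable [BraidedCategory C]

lemma IsComoduleAlgebra.of_mono {H B T : C} [BimonObj H] [MonObj B] [MonObj T] {ρ : B ⟶ B ⊗ H}
    (hρ : IsComoduleAlgebra H B ρ) (j : T ⟶ B) [IsMonHom j] [Mono j] [Mono (j ▷ H)]
    [Mono (j ▷ (H ⊗ H))] {ρT : T ⟶ T ⊗ H} (hρT : ρT ≫ j ▷ H = j ≫ ρ) :
    IsComoduleAlgebra H T ρT where
  comodule := hρ.comodule.of_mono j hρT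
  isMonHom :=
    have := hρ.isMonHom
    { one_hom := by
        rw [← cancel_mono (j ▷ H), Category.assoc, hρT, IsMonHom.one_hom_assoc,
          IsMonHom.one_hom, IsMonHom.one_hom]
      mul_hom := by
        rw [← cancel_mono (j ▷ H), Category.assoc, hρT, IsMonHom.mul_hom_assoc,
          IsMonHom.mul_hom, Category.assoc, IsMonHom.mul_hom, tensorHom_comp_tensorHom_assoc,
          tensorHom_comp_tensorHom_assoc, hρT] }

variable [MonoidalClosed C] {A B H T : C} [MonObj B] [HopfObj H]
  {i : A ⟶ B} {q : H ⟶ B} {j : T ⟶ B} {ρ : B ⟶ B ⊗ H}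

lemma IsCentralizer.exists_coact (hj : IsCentralizer i j) (hH : Flat H)
    (hβ : (β_ A H).hom ≫ (β_ H A).hom = 𝟙 (A ⊗ H)) (hA : IsFinite A) [IsMonHom ρ]
    (hi : i ≫ ρ = i ≫ tensorInl B H) : ∃ ρT : T ⟶ T ⊗ H, ρT ≫ j ▷ H = j ≫ ρ :=
  let := hA.exactPairing
  (hj.comp_tensorInl (dual A) hH hβ).exists_lift _ (hi ▸ hj.centralizes.comp ρ)

theorem IsCentralizer.exists_isGaloisObject [HasEqualizers C] [MonObj A] [IsMonHom i]
    [IsMonHom q] [IsIso (i ⋆ q)] [(tensorLeft A).ReflectsIsomorphisms] (hj : IsCentralizer i j)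
    (hH : Flat H) (hβ : (β_ A H).hom ≫ (β_ H A).hom = 𝟙 (A ⊗ H)) (hA : IsFinite A)
    (hl : IsIso (leftEnvToEnd A)) (hρ : IsComoduleAlgebra H B ρ) (hi : i ≫ ρ = i ≫ tensorInl B H)
    (hq : q ≫ ρ = Δ[H] ≫ q ▷ H) :
    letI := hj.monObj
    ∃ ρT : T ⟶ T ⊗ H, ρT ≫ j ▷ H = j ≫ ρ ∧ IsGaloisObject H T ρT := by
  let := hj.monObj
  let := hA.exactPairing
  have := hj.isMonHom
  have := hj.mono
  have := hj.mono_whiskerRight (dual A) hH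
  have := hj.mono_whiskerRight (dual A) (hH.tensor hH)
  have := hρ.isMonHom
  have := hj.isIso_tensorMul hA hl
  obtain ⟨ρT, hρT⟩ := hj.exists_coact hH hβ hA hi
  have faithfullyFlat : FaithfullyFlat T :=
    have hA' := hA.flat.faithfullyFlat
    hA'.of_tensor <| (hA'.tensor hH.faithfullyFlat_of_bimonObj).of_iso <|
      asIso (i ⋆ q) ≪≫ (asIso (i ⋆ j)).symm
  have isIso_can : IsIso (can H T ρT) :=
    have : IsIso ((tensorLeft A).map (can H T ρT)) := isIso_whiskerLeft_can i q j hi hq hρT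
    isIso_of_reflects_iso (can H T ρT) (tensorLeft A)
  exact ⟨ρT, hρT, hρ.of_mono j hρT, faithfullyFlat, isIso_can⟩

end Galois

section Entwining

variable [BraidedCategory C] {H : C} [BimonObj H]

lemma entwine_natural {M N : Mod C H} (f : M ⟶ N) :
    H ◁ f.hom ≫ entwine H N.X = entwine H M.X ≫ f.hom ▷ H := by
  simp only [entwine, Category.assoc]
  rw [← comp_whiskerRight, act_hom, whisker_exchange_assoc, associator_naturality_right_assoc,
    ← MonoidalCategory.whiskerLeft_comp_assoc, BraidedCategory.braiding_naturality_right]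
  monoidal

lemma entwine_comp_whiskerLeft {X : C} (M : C) [ModObj H M] (f : H ⟶ X) :
    entwine H M ≫ M ◁ f = (Δ[H] ≫ H ◁ f) ▷ M ≫ (α_ H X M).hom ≫ H ◁ (β_ X M).hom ≫
      (α_ H M X).inv ≫ act H M ▷ X := by
  simp only [entwine, Category.assoc]
  rw [← whisker_exchange, ← associator_inv_naturality_right_assoc,
    ← MonoidalCategory.whiskerLeft_comp_assoc, ← BraidedCategory.braiding_naturality_left]
  monoidal

lemma entwine_counit (M : C) [ModObj H M] : entwine H M ≫ M ◁ ε[H] = act H M ≫ (ρ_ M).inv := by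
  rw [entwine_comp_whiskerLeft, ComonObj.comul_counit, braiding_tensorUnit_left]
  monoidal

lemma entwine_comul (M : C) [ModObj H M] :
    entwine H M ≫ M ◁ Δ[H] ≫ (α_ M H H).inv =
      Δ[H] ▷ M ≫ (α_ H H M).hom ≫ H ◁ (β_ H M).hom ≫ (α_ H M H).inv ≫ entwine H M ▷ H := by
  symm
  calc
    _ = Δ[H] ▷ M ≫ (α_ H H M).hom ≫ (H ◁ (β_ H M).hom ≫ Δ[H] ▷ (M ⊗ H)) ≫
        (α_ (H ⊗ H) M H).inv ≫
          ((α_ H H M).hom ≫ H ◁ (β_ H M).hom ≫ (α_ H M H).inv ≫ act H M ▷ H) ▷ H := by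
      rw [entwine]; monoidal
    _ = (Δ[H] ≫ Δ[H] ▷ H) ▷ M ≫ (α_ (H ⊗ H) H M).hom ≫ (H ⊗ H) ◁ (β_ H M).hom ≫
        (α_ (H ⊗ H) M H).inv ≫
          ((α_ H H M).hom ≫ H ◁ (β_ H M).hom ≫ (α_ H M H).inv ≫ act H M ▷ H) ▷ H := by
      rw [whisker_exchange]; monoidal
    _ = (Δ[H] ≫ H ◁ Δ[H]) ▷ M ≫ (α_ H (H ⊗ H) M).hom ≫ H ◁ (β_ (H ⊗ H) M).hom ≫
        (α_ H M (H ⊗ H)).inv ≫ act H M ▷ (H ⊗ H) ≫ (α_ M H H).inv := by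
      rw [ComonObj.comul_assoc, BraidedCategory.braiding_tensor_left_hom]; monoidal
    _ = _ := by
      rw [← Category.assoc (entwine H M), entwine_comp_whiskerLeft]; monoidal

attribute [local instance] ModObj.regular in
lemma entwine_tensor (M N : C) [ModObj H M] [ModObj H N] :
    entwine H (M ⊗ N) = (α_ H M N).inv ≫ entwine H M ▷ N ≫ (α_ M H N).hom ≫
      M ◁ entwine H N ≫ (α_ M N H).inv := by
  have diagAct_tensor : diagAct H (M ⊗ N) H ≫ (α_ M N H).hom =
      H ◁ (α_ M N H).hom ≫ diagAct H M (N ⊗ H) :=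
    diagAct_assoc ⟨M⟩ ⟨N⟩ ⟨H⟩
  rw [← cancel_mono (α_ M N H).hom]
  calc
    _ = H ◁ ((ρ_ (M ⊗ N)).inv ≫ (M ⊗ N) ◁ η[H]) ≫ H ◁ (α_ M N H).hom ≫
        (α_ H M (N ⊗ H)).inv ≫ entwine H M ▷ (N ⊗ H) ≫ (α_ M H (N ⊗ H)).hom ≫
          M ◁ diagAct H N H := by
      rw [entwine_eq, Category.assoc, diagAct_tensor, diagAct_eq, act_tensor]
    _ = (α_ H M N).inv ≫ ((H ⊗ M) ◁ ((ρ_ N).inv ≫ N ◁ η[H]) ≫ entwine H M ▷ (N ⊗ H)) ≫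
        (α_ M H (N ⊗ H)).hom ≫ M ◁ diagAct H N H := by
      monoidal
    _ = _ := by
      rw [whisker_exchange, entwine_eq N]; monoidal

lemma entwine_unit : entwine H (𝟙_ C) = (ρ_ H).hom ≫ (λ_ H).inv := by
  calc
    _ = (Δ[H] ≫ ε[H] ▷ H) ▷ 𝟙_ C ≫ (ρ_ (𝟙_ C ⊗ H)).hom := by
      rw [entwine, act_unit, unitAct, braiding_tensorUnit_right]; monoidal
    _ = _ := by
      rw [ComonObj.counit_comul]; monoidal

lemma entwine_of_trivial (X : C) [ModObj H X] (h : act H X = ε[H] ▷ X ≫ (λ_ X).hom) :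
    entwine H X = (β_ H X).hom := by
  calc
    _ = Δ[H] ▷ X ≫ (α_ H H X).hom ≫ (H ◁ (β_ H X).hom ≫ ε[H] ▷ (X ⊗ H)) ≫ (λ_ (X ⊗ H)).hom := by
      rw [entwine, h]; monoidal
    _ = (Δ[H] ≫ ε[H] ▷ H) ▷ X ≫ (α_ (𝟙_ C) H X).hom ≫ 𝟙_ C ◁ (β_ H X).hom ≫
        (λ_ (X ⊗ H)).hom := by
      rw [whisker_exchange]; monoidal
    _ = _ := by
      rw [ComonObj.counit_comul]; monoidal

variable (H) in
/-- The trivial `H`-action on an object, given by the counit of `H`. -/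
abbrev trivModObj (X : C) : ModObj H X where
  smul := ε[H] ▷ X ≫ (λ_ X).hom
  one_smul := by
    change η[H] ▷ X ≫ ε[H] ▷ X ≫ (λ_ X).hom = (λ_ X).hom
    rw [← comp_whiskerRight_assoc, BimonObj.one_counit, id_whiskerRight, Category.id_comp]
  mul_smul := by
    have mul_counit : μ[H] ≫ ε[H] = H ◁ ε[H] ≫ ε[H] ▷ 𝟙_ C ≫ (λ_ (𝟙_ C)).hom := by
      rw [BimonObj.mul_counit, ← Category.assoc, ← MonoidalCategory.tensorHom_def']
      rfl
    change μ[H] ▷ X ≫ ε[H] ▷ X ≫ (λ_ X).hom =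
      (α_ H H X).hom ≫ H ◁ (ε[H] ▷ X ≫ (λ_ X).hom) ≫ ε[H] ▷ X ≫ (λ_ X).hom
    rw [← comp_whiskerRight_assoc, mul_counit]
    monoidal

variable (H) in
/-- The object `X` as an `H`-module with the trivial action. -/
def trivMod (X : C) : Mod C H :=
  let := trivModObj H X
  ⟨X⟩

attribute [local instance] ModObj.regular in
/-- This is the linearity of the braiding of the trivial module `X` with the regular module,
evaluated at `h ⊗ x ⊗ 1`. -/
lemma braiding_comp_braiding [BraidingLinear H] (X : C) :
    (β_ H X).hom ≫ (β_ X H).hom = 𝟙 (H ⊗ X) := by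
  let := trivModObj H X
  have linear : diagAct H X H ≫ (β_ X H).hom = H ◁ (β_ X H).hom ≫ diagAct H H X :=
    BraidingLinear.linear (trivMod H X) (Mod.regular H)
  have diagAct_trivial : diagAct H H X = (α_ H H X).inv ≫ μ[H] ▷ X := by
    calc
      _ = (α_ H H X).inv ≫ (entwine H H ≫ H ◁ ε[H]) ▷ X ≫ (α_ H (𝟙_ C) X).hom ≫
          H ◁ (λ_ X).hom := by
        rw [diagAct_eq, show act H X = ε[H] ▷ X ≫ (λ_ X).hom from rfl]; monoidal
      _ = _ := by
        rw [entwine_counit, act_regular]; monoidal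
  calc
    _ = H ◁ ((ρ_ X).inv ≫ X ◁ η[H] ≫ (β_ X H).hom) ≫ diagAct H H X := by
      rw [← entwine_of_trivial (H := H) X rfl, entwine_eq, Category.assoc, linear,
        ← MonoidalCategory.whiskerLeft_comp_assoc, Category.assoc]
    _ = H ◁ (λ_ X).inv ≫ (α_ H (𝟙_ C) X).inv ≫ (H ◁ η[H] ≫ μ[H]) ▷ X := by
      rw [BraidedCategory.braiding_naturality_right, braiding_tensorUnit_right, diagAct_trivial]
      monoidal
    _ = 𝟙 (H ⊗ X) := by
      rw [MonObj.mul_one]; monoidal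

lemma braiding_comp_braiding' [BraidingLinear H] (X : C) :
    (β_ X H).hom ≫ (β_ H X).hom = 𝟙 (X ⊗ H) := by
  rw [← cancel_epi (β_ H X).hom, reassoc_of% braiding_comp_braiding (H := H) X, Category.comp_id]

end Entwining

section Smash

variable [BraidedCategory C] {H : C} [BimonObj H] (A : Mod C H)

lemma isRightComodule_smashCoact : IsRightComodule H (smashCoact A) where
  counit := by
    calc
      _ = A.X ◁ (Δ[H] ≫ H ◁ ε[H]) ≫ (α_ A.X H (𝟙_ C)).inv := by
        rw [smashCoact]; monoidal
      _ = _ := by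
        rw [ComonObj.comul_counit]; monoidal
  coassoc := by
    calc
      _ = A.X ◁ (Δ[H] ≫ H ◁ Δ[H]) ≫ (α_ A.X H (H ⊗ H)).inv := by
        rw [smashCoact]; monoidal
      _ = _ := by
        rw [ComonObj.comul_assoc, smashCoact]; monoidal

variable [MonObj A]

instance : IsDistributiveLaw (entwine H A.X) where
  one_left := one_entwine A.X
  one_right := by
    have natural : H ◁ η[A.X] ≫ entwine H A.X = entwine H (𝟙_ C) ≫ η[A.X] ▷ H :=
      entwine_natural (η[A] : 𝟙_ (Mod C H) ⟶ A)
    rw [natural, entwine_unit, Category.assoc, tensorInr]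
  mul_left := mul_entwine A.X
  mul_right := by
    have natural : H ◁ μ[A.X] ≫ entwine H A.X = entwine H (A.X ⊗ A.X) ≫ μ[A.X] ▷ H :=
      entwine_natural (μ[A] : A ⊗ A ⟶ A)
    rw [natural, entwine_tensor]
    simp only [Category.assoc]

/-- The smash product with its algebra structure, as a twisted tensor product. -/
abbrev smashAlgebra : C := twistTensor (entwine H A.X)

/-- The embedding of `A` in `A # H`. -/
abbrev smashInl : A.X ⟶ smashAlgebra A := twistInl (entwine H A.X)

/-- The embedding of `H` in `A # H`. -/
abbrev smashInr : H ⟶ smashAlgebra A := twistInr (entwine H A.X)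

/-- The coaction on the smash product, as a morphism of the algebra `A # H`. -/
def smashAlgebraCoact : smashAlgebra A ⟶ smashAlgebra A ⊗ H := smashCoact A

lemma smashAlgebraCoact_eq_tensorMul : smashAlgebraCoact A =
    (smashInl A ≫ tensorInl (smashAlgebra A) H) ⋆ (Δ[H] ≫ smashInr A ▷ H) := by
  rw [comp_tensorInl_tensorMul, twistInl_tensorMul_twistInr]
  change A.X ◁ Δ[H] ≫ (α_ A.X H H).inv = A.X ◁ Δ[H] ≫ (α_ A.X H H).inv ≫ 𝟙 (A.X ⊗ H) ▷ H
  rw [id_whiskerRight, Category.comp_id]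

instance : IsMonHom (smashAlgebraCoact A) := by
  have exchange : entwine H A.X ≫ smashAlgebraCoact A =
      (Δ[H] ≫ smashInr A ▷ H) ⋆ (smashInl A ≫ tensorInl (smashAlgebra A) H) := by
    rw [tensorMul_comp_tensorInl, twistInr_tensorMul_twistInl]
    exact entwine_comul A.X
  rw [smashAlgebraCoact_eq_tensorMul] at exchange ⊢
  exact isMonHom_tensorMul (entwine H A.X) _ _ exchange

lemma isComoduleAlgebra_smashAlgebraCoact :
    IsComoduleAlgebra H (smashAlgebra A) (smashAlgebraCoact A) where
  comodule := isRightComodule_smashCoact A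
  isMonHom := inferInstance

lemma smashInl_comp_smashAlgebraCoact :
    smashInl A ≫ smashAlgebraCoact A = smashInl A ≫ tensorInl (smashAlgebra A) H := by
  rw [smashAlgebraCoact_eq_tensorMul]
  exact tensorInl_comp_tensorMul _ _

lemma smashInr_comp_smashAlgebraCoact :
    smashInr A ≫ smashAlgebraCoact A = Δ[H] ≫ smashInr A ▷ H := by
  rw [smashAlgebraCoact_eq_tensorMul]
  exact tensorInr_comp_tensorMul _ _

end Smash

section Descent

variable {H : C}

lemma isIso_hom [MonObj H] {M N : Mod C H} (f : M ⟶ N) [IsIso f] : IsIso f.hom :=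
  ⟨(inv f).hom, congrArg Mod.Hom.hom (IsIso.hom_inv_id f),
    congrArg Mod.Hom.hom (IsIso.inv_hom_id f)⟩

lemma isIso_of_isIso_hom [MonObj H] {M N : Mod C H} (f : M ⟶ N) [IsIso f.hom] : IsIso f :=
  inferInstanceAs (IsIso (isoMk (asIso f.hom) (act_hom f)).hom)

lemma curry_ihom_ev [MonoidalClosed C] (X Y : C) :
    MonoidalClosed.curry ((ihom.ev X).app Y) = 𝟙 ((ihom X).obj Y) := by
  rw [← MonoidalClosed.uncurry_id_eq_ev, MonoidalClosed.curry_uncurry]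

variable [BraidedCategory C] [MonoidalClosed C] [HopfObj H] [BraidingLinear H]

lemma curry_eq_ihomModEquiv {M X N : Mod C H} (f : M ⊗ X ⟶ N) :
    MonoidalClosed.curry f = ihomModEquiv M X N f :=
  congrFun (congrArg DFunLike.coe (congrFun (congrFun
    (Adjunction.mkOfHomEquiv_homEquiv (F := tensorLeft M)
      (G := Adjunction.rightAdjointOfEquiv (F := tensorLeft M) (ihomModEquiv M)
        fun X' X N f g => Mod.hom_ext (ihomModEquiv M X' N ((tensorLeft M).map f ≫ g))
          (f ≫ ihomModEquiv M X N g) (MonoidalClosed.curry_natural_left f.hom g.hom)) _) X) N)) f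

lemma curry_hom {M X N : Mod C H} (f : M ⊗ X ⟶ N) :
    (MonoidalClosed.curry f).hom = MonoidalClosed.curry f.hom :=
  congrArg Mod.Hom.hom (curry_eq_ihomModEquiv f)

lemma ihom_ev_hom (M N : Mod C H) : ((ihom.ev M).app N).hom = (ihom.ev M.X).app N.X :=
  MonoidalClosed.curry_injective <| (curry_hom _).symm.trans <|
    (congrArg Mod.Hom.hom (curry_ihom_ev M N)).trans (curry_ihom_ev M.X N.X).symm

lemma evDual_hom (A : Mod C H) : (evDual A).hom = evDual A.X :=
  ihom_ev_hom A (𝟙_ (Mod C H))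

lemma dualToEnd_hom (A : Mod C H) : (dualToEnd A).hom = dualToEnd A.X := by
  rw [dualToEnd, curry_hom]
  change MonoidalClosed.curry ((α_ _ _ _).inv ≫ (evDual A).hom ▷ _ ≫ (λ_ _).hom) = _
  rw [evDual_hom]
  rfl

lemma leftEnvToEnd_hom (A : Mod C H) [MonObj A] : (leftEnvToEnd A).hom = leftEnvToEnd A.X :=
  curry_hom _

lemma IsFinite.of_mod {A : Mod C H} (hA : IsFinite A) : IsFinite A.X := by
  have : IsIso (dualToEnd A) := hA
  have := isIso_hom (dualToEnd A)
  rwa [dualToEnd_hom] at this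

lemma isIso_leftEnvToEnd_of_mod {A : Mod C H} [MonObj A] (_ : IsIso (leftEnvToEnd A)) :
    IsIso (leftEnvToEnd A.X) :=
  leftEnvToEnd_hom A ▸ isIso_hom (leftEnvToEnd A)

/-- A morphism of `C` is linear for the trivial actions, which reduces the claim to `Mod C H`. -/
lemma IsFaithfullyProjective.reflectsIsomorphisms_tensorLeft_of_mod {A : Mod C H}
    (hA : IsFaithfullyProjective A) : (tensorLeft A.X).ReflectsIsomorphisms where
  reflects {X Y} f hf := by
    have linear : (ε[H] ▷ X ≫ (λ_ X).hom) ≫ f = H ◁ f ≫ ε[H] ▷ Y ≫ (λ_ Y).hom := by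
      rw [whisker_exchange_assoc, Category.assoc, leftUnitor_naturality]
    let f' : trivMod H X ⟶ trivMod H Y := homMk f linear
    have : IsIso (A ◁ f').hom := hf
    have := hA.reflectsIsomorphisms_tensorLeft
    have : IsIso ((tensorLeft A).map f') := isIso_of_isIso_hom (A ◁ f')
    have := isIso_of_reflects_iso f' (tensorLeft A)
    exact isIso_hom f'

end Descent

end BraidedHopf

end

theorem mainTheorem3_general {C : Type u} [Category.{v} C] [MonoidalCategory C]
    [BraidedCategory C] [MonoidalClosed C] [HasEqualizers C]
    (H : C) [HopfObj H] [BraidingLinear H] (hH : Flat H)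
    (A : CategoryTheory.Mod C H) [MonObj A] (hP : IsFaithfullyProjective A)
    (hl : IsIso (leftEnvToEnd A)) :
    ∃ (_ : MonObj (smashInvariants A)) (ρ : smashInvariants A ⟶ smashInvariants A ⊗ H),
      μ[smashInvariants A] ≫ smashInvariantsι A =
        (smashInvariantsι A ⊗ₘ smashInvariantsι A) ≫ smashMul A ∧
      η[smashInvariants A] ≫ smashInvariantsι A = smashOne A ∧
      ρ ≫ smashInvariantsι A ▷ H = smashInvariantsι A ≫ smashCoact A ∧
      IsGaloisObject H (smashInvariants A) ρ := by
  have isCentralizer : IsCentralizer (smashInl A) (smashInvariantsι A) :=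
    isCentralizer_invariantsι (smashInl A)
  let := isCentralizer.monObj
  have isMonHom := isCentralizer.isMonHom
  have := hP.reflectsIsomorphisms_tensorLeft_of_mod
  obtain ⟨ρ, coact_eq, isGaloisObject⟩ := isCentralizer.exists_isGaloisObject hH
    (braiding_comp_braiding' A.X) hP.finite.of_mod (isIso_leftEnvToEnd_of_mod hl)
    (isComoduleAlgebra_smashAlgebraCoact A) (smashInl_comp_smashAlgebraCoact A)
    (smashInr_comp_smashAlgebraCoact A)
  exact ⟨inferInstance, ρ, isMonHom.mul_hom, isMonHom.one_hom.trans one_comp_tensorInl,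
    coact_eq, isGaloisObject⟩

theorem mainTheorem3 {C : Type u} [Category.{v} C] [MonoidalCategory C] [BraidedCategory C]
    [MonoidalClosed C] [HasEqualizers C] [HasCoequalizers C]
    (H : C) [HopfObj H] [BraidingLinear H] (hH : Flat H)
    (A : CategoryTheory.Mod C H) [MonObj A] (hA : IsAzumayaAlgebra A) :
    ∃ (_ : MonObj (smashInvariants A)) (ρ : smashInvariants A ⟶ smashInvariants A ⊗ H),
      μ[smashInvariants A] ≫ smashInvariantsι A =
        (smashInvariantsι A ⊗ₘ smashInvariantsι A) ≫ smashMul A ∧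
      η[smashInvariants A] ≫ smashInvariantsι A = smashOne A ∧
      ρ ≫ smashInvariantsι A ▷ H = smashInvariantsι A ≫ smashCoact A ∧
      IsGaloisObject H (smashInvariants A) ρ :=
  mainTheorem3_general H hH A hA.faithfullyProjective hA.isIso_left
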